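/- Let $n\ge 0$, let $\mathbb K=\mathbb R(q)$ be the field of rational functions in a formal parameter $q$, and let $\mathfrak S_n$ act on polynomials in $\mathbf x=(x_1,\dots,x_n)$ by permuting the variables. For $k\ge 1$ put $$D_{k;q}=\sum_{i=1}^n\left(q\,x_i\,\partial_i^{k+1}+\partial_i^{k}\right),\qquad \mathcal H_{\mathbf x;q}=\{f\in\mathbb K[\mathbf x] : D_{k;q}f=0\ \text{for all } k\ge 1\}.$$ If $f\in\mathcal H_{\mathbf x;q}$ is of the form $f=q^r(f_0+q f_1+\dots+q^m f_m)$ with $r\in\mathbb Z$, $m\ge 0$, $f_i\in\mathbb R[\mathbf x]$, $f_0\ne 0$ and $f_m\neq 0$, call $\mathrm{FT}(f)=f_0$ its first term and $\mathrm{LT}(f)=f_m$ its last term. Let $\mathcal H^F_{\mathbf x},\mathcal H^L_{\mathbf x}\subseteq\mathbb R[\mathbf x]$ be the real linear spans of all $\mathrm{FT}(f)$, respectively all $\mathrm{LT}(f)$, for such $f$. For a field $F$ let $\mathcal H_{\mathfrak S_n}(F)$ be the space of classical $\mathfrak S_n$-harmonics, that is, of those $f\in F[\mathbf x]$ with $p(\partial_1,\dots,\partial_n)f=0$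 for every symmetric polynomial $p\in F[\mathbf x]$ without constant term. Then $\mathcal H^F_{\mathbf x}$, $\mathcal H^L_{\mathbf x}$ and $\mathcal H_{\mathbf x;q}$ are stable under $\mathfrak S_n$ and graded by degree, and they are equivalent as graded $\mathfrak S_n$-modules: there are isomorphisms of graded $\mathfrak S_n$-modules $$\mathcal H^F_{\mathbf x}\cong\mathcal H^L_{\mathbf x}\ \text{ over }\mathbb R,\qquad \mathbb K\otimes_{\mathbb R}\mathcal H^F_{\mathbf x}\cong\mathcal H_{\mathbf x;q}\cong\mathbb K\otimes_{\mathbb R}\mathcal H^L_{\mathbf x}\ \text{ over }\mathbb K.$$ Moreover, each of $\mathcal H^F_{\mathbf x}$ and $\mathcal H^L_{\mathbf x}$ is isomorphic, as a graded $\mathfrak S_n$-module, to a graded $\mathfrak S_n$-submodule of $\mathcal H_{\mathfrak S_n}(\mathbb R)$, and $\mathcal H_{\mathbf x;q}$ is isomorphic, as a graded $\mathfrak S_n$-module, to a graded $\mathfrak S_n$-submodule of $\mathcal H_{\mathfrak S_n}(\mathbb K)$. -/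

import Mathlib

open MvPolynomial
open scoped TensorProduct

noncomputable section

namespace QHarm

/-- The symmetric group acts on `F[x₁,…,xₙ]` by permuting the variables. -/
def permRep (F : Type*) [Field F] (n : ℕ) :
    Representation F (Equiv.Perm (Fin n)) (MvPolynomial (Fin n) F) where
  toFun s := (rename s).toLinearMap
  map_one' := LinearMap.ext fun f => rename_id_apply f
  map_mul' s t := LinearMap.ext fun f => (rename_rename t s f).symm

/-- The partial derivative `∂ᵢ`, as a linear operator. -/
def del (F : Type*) [Field F] {n : ℕ} (i : Fin n) : Module.End F (MvPolynomial (Fin n) F) :=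
  (pderiv i).toLinearMap

/-- Multiplication by `xᵢ`, as a linear operator. -/
def mulX (F : Type*) [Field F] {n : ℕ} (i : Fin n) : Module.End F (MvPolynomial (Fin n) F) :=
  LinearMap.mulLeft F (X i)

/-- The operator `D_{k;q} = ∑ᵢ (q xᵢ ∂ᵢ^(k+1) + ∂ᵢ^k)`. -/
def qSteenrod {F : Type*} [Field F] (n : ℕ) (q : F) (k : ℕ) :
    Module.End F (MvPolynomial (Fin n) F) :=
  ∑ i : Fin n, (q • (mulX F i * del F i ^ (k + 1)) + del F i ^ k)

/-- The differential operator `p(∂₁,…,∂ₙ)` with constant coefficients. -/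
def diffOp {F : Type*} [Field F] {n : ℕ} (p : MvPolynomial (Fin n) F) :
    Module.End F (MvPolynomial (Fin n) F) :=
  ∑ a ∈ p.support, p.coeff a • (List.ofFn fun i => del F i ^ a i).prod

/-- The classical `Sₙ`-harmonic polynomials: those killed by `p(∂)` for every symmetric
polynomial `p` without constant term. -/
def harmonics (F : Type*) [Field F] (n : ℕ) : Submodule F (MvPolynomial (Fin n) F) where
  carrier := {f | ∀ p : MvPolynomial (Fin n) F, p.IsSymmetric → constantCoeff p = 0 →
    diffOp p f = 0}
  add_mem' hf hg p hp h0 := by rw [map_add, hf p hp h0, hg p hp h0, add_zero]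
  zero_mem' p _ _ := map_zero _
  smul_mem' c f hf p hp h0 := by rw [map_smul, hf p hp h0, smul_zero]

lemma permRep_del_pow {F : Type*} [Field F] {n : ℕ} (s : Equiv.Perm (Fin n)) (i : Fin n) (k : ℕ)
    (f : MvPolynomial (Fin n) F) :
    (del F (s i) ^ k) (permRep F n s f) = permRep F n s ((del F i ^ k) f) := by
  induction k with
  | zero => rfl
  | succ k ih =>
    rw [pow_succ', Module.End.mul_apply, ih, pow_succ', Module.End.mul_apply]
    exact pderiv_rename s.injective i _

lemma permRep_qSteenrod {F : Type*} [Field F] {n : ℕ} (q : F) (k : ℕ) (s : Equiv.Perm (Fin n))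
    (f : MvPolynomial (Fin n) F) :
    qSteenrod n q k (permRep F n s f) = permRep F n s (qSteenrod n q k f) := by
  simp only [qSteenrod, LinearMap.sum_apply, map_sum]
  rw [← Equiv.sum_comp s]
  refine Finset.sum_congr rfl fun i _ => ?_
  simp only [LinearMap.add_apply, LinearMap.smul_apply, Module.End.mul_apply, permRep_del_pow,
    map_add, map_smul]
  simp [mulX, permRep]

/-- The field `ℝ(q)`; the formal parameter `q` is `RatFunc.X`. -/
abbrev K : Type := RatFunc ℝ

/-- The space of `q`-harmonic polynomials in `n` variables, for a formal parameter `q`: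
the polynomials over `ℝ(q)` killed by all `D_{k;q}`, `k ≥ 1`, with its action of `Sₙ`. -/
def qHarmonics (n : ℕ) : Subrepresentation (permRep K n) where
  toSubmodule :=
    { carrier := {f | ∀ k : ℕ, 1 ≤ k → qSteenrod n (RatFunc.X : K) k f = 0}
      add_mem' := fun hf hg k hk => by rw [map_add, hf k hk, hg k hk, add_zero]
      zero_mem' := fun k _ => map_zero _
      smul_mem' := fun c f hf k hk => by rw [map_smul, hf k hk, smul_zero] }
  apply_mem_toSubmodule s f hf k hk := by rw [permRep_qSteenrod, hf k hk, map_zero]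

/-- `f = q^r (c₀ + q c₁ + ⋯ + q^m c_m)` with real polynomials `cᵢ`, and `c₀` and `c_m` nonzero.
Then `c₀` is the first term and `c_m` the last term of `f`. -/
def IsQExpansion {n : ℕ} (f : MvPolynomial (Fin n) K) (r : ℤ) (m : ℕ)
    (c : ℕ → MvPolynomial (Fin n) ℝ) : Prop :=
  c 0 ≠ 0 ∧ c m ≠ 0 ∧
    f = C ((RatFunc.X : K) ^ r) *
      ∑ i ∈ Finset.range (m + 1), C ((RatFunc.X : K) ^ i) * map (algebraMap ℝ K) (c i)

lemma IsQExpansion.perm {n : ℕ} {f : MvPolynomial (Fin n) K} {r : ℤ} {m : ℕ}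
    {c : ℕ → MvPolynomial (Fin n) ℝ} (h : IsQExpansion f r m c) (s : Equiv.Perm (Fin n)) :
    IsQExpansion (permRep K n s f) r m (fun i => permRep ℝ n s (c i)) := by
  have inj : ∀ g : MvPolynomial (Fin n) ℝ, g ≠ 0 → permRep ℝ n s g ≠ 0 := fun g hg h0 =>
    hg (rename_injective s s.injective (by rw [map_zero]; exact h0))
  refine ⟨inj _ h.1, inj _ h.2.1, ?_⟩
  rw [h.2.2]
  simp [permRep, map_rename]

/-- The first terms of `q`-harmonics. -/
def firstTerms (n : ℕ) : Set (MvPolynomial (Fin n) ℝ) :=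
  {g | ∃ f ∈ (qHarmonics n).toSubmodule, ∃ r m c, IsQExpansion f r m c ∧ g = c 0}

/-- The last terms of `q`-harmonics. -/
def lastTerms (n : ℕ) : Set (MvPolynomial (Fin n) ℝ) :=
  {g | ∃ f ∈ (qHarmonics n).toSubmodule, ∃ r m c, IsQExpansion f r m c ∧ g = c m}

lemma span_stable {n : ℕ} {S : Set (MvPolynomial (Fin n) ℝ)} (s : Equiv.Perm (Fin n))
    (hS : ∀ g ∈ S, permRep ℝ n s g ∈ S) {g : MvPolynomial (Fin n) ℝ}
    (hg : g ∈ Submodule.span ℝ S) : permRep ℝ n s g ∈ Submodule.span ℝ S := by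
  have h : Submodule.span ℝ S ≤ (Submodule.span ℝ S).comap (permRep ℝ n s) :=
    Submodule.span_le.2 fun x hx => Submodule.subset_span (hS x hx)
  exact h hg

/-- The real span of the first terms of `q`-harmonics, with its action of `Sₙ`. -/
def firstTermSpan (n : ℕ) : Subrepresentation (permRep ℝ n) where
  toSubmodule := Submodule.span ℝ (firstTerms n)
  apply_mem_toSubmodule s _ hg := by
    refine span_stable s ?_ hg
    rintro _ ⟨f, hf, r, m, c, h, rfl⟩
    exact ⟨_, (qHarmonics n).apply_mem_toSubmodule s hf, r, m, _, h.perm s, rfl⟩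

/-- The real span of the last terms of `q`-harmonics, with its action of `Sₙ`. -/
def lastTermSpan (n : ℕ) : Subrepresentation (permRep ℝ n) where
  toSubmodule := Submodule.span ℝ (lastTerms n)
  apply_mem_toSubmodule s _ hg := by
    refine span_stable s ?_ hg
    rintro _ ⟨f, hf, r, m, c, h, rfl⟩
    exact ⟨_, (qHarmonics n).apply_mem_toSubmodule s hf, r, m, _, h.perm s, rfl⟩

/-- The degree `d` part of an `Sₙ`-stable space of polynomials. -/
def degPart {F : Type*} [Field F] {n : ℕ} (U : Subrepresentation (permRep F n)) (d : ℕ) :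
    Submodule F U.toSubmodule :=
  (homogeneousSubmodule (Fin n) F d).comap U.toSubmodule.subtype

/-- An `Sₙ`-stable space of polynomials is graded if it contains the homogeneous components of
its elements, that is, if it is the direct sum of its degree parts. -/
def IsGraded {F : Type*} [Field F] {n : ℕ} (U : Subrepresentation (permRep F n)) : Prop :=
  ∀ f ∈ U.toSubmodule, ∀ d : ℕ, homogeneousComponent d f ∈ U.toSubmodule

/-- Two representations of `G`, graded by `𝒱` and `𝒲`, are isomorphic as graded `G`-modules:
some linear `G`-equivariant isomorphism maps each degree part onto the degree part of the same
degree. -/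
def GradedIso {F G V W : Type*} [Field F] [Group G] [AddCommGroup V] [Module F V]
    [AddCommGroup W] [Module F W] (ρ : Representation F G V) (𝒱 : ℕ → Submodule F V)
    (τ : Representation F G W) (𝒲 : ℕ → Submodule F W) : Prop :=
  ∃ e : V ≃ₗ[F] W, (∀ g v, e (ρ g v) = τ g (e v)) ∧
    ∀ d, (𝒱 d).map (e : V →ₗ[F] W) = 𝒲 d

/-- `GradedIso` for two `Sₙ`-stable spaces of polynomials over the same field. -/
def SubIso {F : Type*} [Field F] {n : ℕ} (U W : Subrepresentation (permRep F n)) : Prop :=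
  GradedIso U.toRepresentation (degPart U) W.toRepresentation (degPart W)

/-- Extension of scalars `L ⊗ V` of a representation. -/
def extendScalars {F : Type*} (L : Type*) {G V : Type*} [Field F] [Field L] [Algebra F L] [Group G]
    [AddCommGroup V] [Module F V] (ρ : Representation F G V) :
    Representation L G (L ⊗[F] V) where
  toFun g := (ρ g).baseChange L
  map_one' := by rw [map_one]; exact LinearMap.baseChange_id
  map_mul' g h := by rw [map_mul]; exact LinearMap.baseChange_mul (ρ g) (ρ h)

/-- The real graded `Sₙ`-module `U` and the graded `Sₙ`-module `W` over `ℝ(q)` are equivalent: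
`ℝ(q) ⊗ U` and `W` are isomorphic as graded `Sₙ`-modules over `ℝ(q)`. -/
def ExtIso {n : ℕ} (U : Subrepresentation (permRep ℝ n)) (W : Subrepresentation (permRep K n)) :
    Prop :=
  GradedIso (extendScalars K U.toRepresentation) (fun d => (degPart U d).baseChange K)
    W.toRepresentation (degPart W)

/-- `U` is isomorphic, as a graded `Sₙ`-module, to a graded submodule of the `Sₙ`-harmonics. -/
def EmbedsInHarmonics {F : Type*} [Field F] {n : ℕ} (U : Subrepresentation (permRep F n)) : Prop :=
  ∃ W : Subrepresentation (permRep F n),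
    W.toSubmodule ≤ harmonics F n ∧ IsGraded W ∧ SubIso U W

end QHarm

end

/-! For `p = q` or `p = q⁻¹`, let `A = reduction p U` be the real space of constant terms of those
elements of the `q`-harmonic space `U` that are polynomials in `p`. First terms are the case `p =
q`; reversing coefficients shows that last terms are the case `p = q⁻¹`.

`A` is the special fibre of a lattice in `U`, so `U` is isomorphic to the scalar extension of `A`
(`subIso_scalarExt_reduction`). The isomorphism is the extension to `ℝ(q)` of a graded equivariant
projection `π` onto `A`, restricted to `U`. It is injective because a nonzero element of `U`
rescales to one with nonzero constant term, which lies in `A` and is fixed by `π`. It is onto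
because, in each degree, lifts of a basis of `A` have images whose coordinate matrix is the identity
at `p = 0`, hence invertible.

The two choices of `p` make the scalar extensions of first and last terms isomorphic. Clearing
denominators in each degree and specializing `q` to a real number that avoids their zeros brings
this isomorphism down to `ℝ` (`subIso_of_subIso_scalarExt`).

The shape of `D_{k;q}` matters only twice: it is homogeneous, so `U` is graded, and the coefficient
of `q⁰` in `D_{k;q} f = 0` says that `∑ ∂ᵢ^k` kills the first term. In characteristic zero, power
sums generate the symmetric polynomials, so first terms are harmonic. -/

noncomputable section

namespace QHarm

/-! ### Expansions in powers of `p`, and real operators extended to `ℝ(q)` -/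

variable {n : ℕ}

/-- Substitution of `p ∈ ℝ(q)` for the indeterminate `T` in `∑ T^i cᵢ`, for real polynomials
`cᵢ`. -/
def expand (p : K) : Polynomial (MvPolynomial (Fin n) ℝ) →+* MvPolynomial (Fin n) K :=
  Polynomial.eval₂RingHom (map (algebraMap ℝ K)) (C p)

lemma expand_C (p : K) (f : MvPolynomial (Fin n) ℝ) :
    expand p (Polynomial.C f) = map (algebraMap ℝ K) f := by
  simp [expand]

lemma expand_X (p : K) : expand p (Polynomial.X : Polynomial (MvPolynomial (Fin n) ℝ)) = C p := by
  simp [expand]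

lemma expand_monomial (p : K) (i : ℕ) (f : MvPolynomial (Fin n) ℝ) :
    expand p (Polynomial.monomial i f) = p ^ i • map (algebraMap ℝ K) f := by
  simp [expand, smul_eq_C_mul, mul_comm]

lemma expand_eq_sum (p : K) (Q : Polynomial (MvPolynomial (Fin n) ℝ)) {N : ℕ}
    (hN : Q.natDegree < N) :
    expand p Q = ∑ i ∈ Finset.range N, p ^ i • map (algebraMap ℝ K) (Q.coeff i) := by
  conv_lhs => rw [Q.as_sum_range' N hN]
  simp only [map_sum, expand_monomial]

/-- The coefficient of each monomial in `x` gives a real polynomial relation for `p`, which must be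
trivial. Identities over `ℝ(q)` can therefore be read off power by power. -/
lemma expand_injective {p : K} (hp : Transcendental ℝ p) :
    Function.Injective (expand (n := n) p) := by
  rw [injective_iff_map_eq_zero]
  intro Q hQ
  ext i a
  rw [expand_eq_sum p Q (Nat.lt_succ_self _)] at hQ
  have h := congrArg (coeff a) hQ
  simp only [coeff_sum, coeff_smul, coeff_map, coeff_zero, smul_eq_mul] at h
  have h2 : Polynomial.aeval p
      (∑ i ∈ Finset.range (Q.natDegree + 1), Polynomial.monomial i ((Q.coeff i).coeff a)) = 0 := by
    rw [← h, map_sum]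
    exact Finset.sum_congr rfl fun i _ => by rw [Polynomial.aeval_monomial, mul_comm]
  have h3 := congrArg (fun P => Polynomial.coeff P i) ((transcendental_iff.1 hp) _ h2)
  simp only [Polynomial.finsetSum_coeff, Polynomial.coeff_monomial, Finset.sum_ite_eq',
    Finset.mem_range, Polynomial.coeff_zero] at h3
  rw [Polynomial.coeff_zero, coeff_zero]
  split_ifs at h3 with hi
  · exact h3
  · rw [Polynomial.coeff_eq_zero_of_natDegree_lt (by omega), coeff_zero]

lemma transcendental_q : Transcendental ℝ (RatFunc.X : K) := RatFunc.transcendental_X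

lemma transcendental_q_inv : Transcendental ℝ (RatFunc.X : K)⁻¹ := fun h =>
  transcendental_q (by simpa using h.inv)

lemma expand_reverse {p : K} (hp : p ≠ 0) (Q : Polynomial (MvPolynomial (Fin n) ℝ)) :
    expand p⁻¹ Q.reverse * C (p ^ Q.natDegree) = expand p Q := by
  let u : (MvPolynomial (Fin n) K)ˣ := ⟨C p, C p⁻¹, by rw [← C_mul, mul_inv_cancel₀ hp, C_1],
    by rw [← C_mul, inv_mul_cancel₀ hp, C_1]⟩
  let _ : Invertible (C p : MvPolynomial (Fin n) K) := u.invertible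
  have h := Polynomial.eval₂_reverse_mul_pow (map (algebraMap ℝ K)) (C p) Q
  have h2 : (⅟(C p) : MvPolynomial (Fin n) K) = C p⁻¹ := rfl
  rw [h2, ← C_pow] at h
  exact h

/-- Coefficientwise application of a linear operator. -/
def coeffMap (φ : Module.End ℝ (MvPolynomial (Fin n) ℝ))
    (Q : Polynomial (MvPolynomial (Fin n) ℝ)) : Polynomial (MvPolynomial (Fin n) ℝ) :=
  ∑ i ∈ Finset.range (Q.natDegree + 1), Polynomial.monomial i (φ (Q.coeff i))

lemma coeff_coeffMap (φ : Module.End ℝ (MvPolynomial (Fin n) ℝ))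
    (Q : Polynomial (MvPolynomial (Fin n) ℝ)) (i : ℕ) :
    (coeffMap φ Q).coeff i = φ (Q.coeff i) := by
  simp only [coeffMap, Polynomial.finsetSum_coeff, Polynomial.coeff_monomial, Finset.sum_ite_eq',
    Finset.mem_range]
  split_ifs with hi
  · rfl
  · rw [Polynomial.coeff_eq_zero_of_natDegree_lt (by omega), map_zero]

/-- The `ℝ(q)`-linear operator `ψ` extends the real operator `φ`. -/
def Extends (φ : Module.End ℝ (MvPolynomial (Fin n) ℝ))
    (ψ : Module.End K (MvPolynomial (Fin n) K)) : Prop :=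
  ∀ f, ψ (map (algebraMap ℝ K) f) = map (algebraMap ℝ K) (φ f)

lemma Extends.expand {φ : Module.End ℝ (MvPolynomial (Fin n) ℝ)}
    {ψ : Module.End K (MvPolynomial (Fin n) K)} (h : Extends φ ψ) (p : K)
    (Q : Polynomial (MvPolynomial (Fin n) ℝ)) :
    ψ (expand p Q) = QHarm.expand p (coeffMap φ Q) := by
  rw [expand_eq_sum p Q (Nat.lt_succ_self _), coeffMap]
  simp only [map_sum, map_smul, expand_monomial, h _]

lemma extends_permRep (s : Equiv.Perm (Fin n)) : Extends (permRep ℝ n s) (permRep K n s) :=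
  fun f => (map_rename _ s f).symm

lemma extends_homogeneousComponent (d : ℕ) :
    Extends (n := n) (homogeneousComponent d) (homogeneousComponent d) := by
  intro f
  ext a
  simp only [coeff_homogeneousComponent, coeff_map]
  split_ifs <;> simp

lemma Extends.comp {φ φ' : Module.End ℝ (MvPolynomial (Fin n) ℝ)}
    {ψ ψ' : Module.End K (MvPolynomial (Fin n) K)} (h : Extends φ ψ) (h' : Extends φ' ψ') :
    Extends (φ * φ') (ψ * ψ') := fun f => by
  simp only [Module.End.mul_apply, h' _, h _]

lemma Extends.pow {φ : Module.End ℝ (MvPolynomial (Fin n) ℝ)}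
    {ψ : Module.End K (MvPolynomial (Fin n) K)} (h : Extends φ ψ) (k : ℕ) :
    Extends (φ ^ k) (ψ ^ k) := by
  induction k with
  | zero => exact fun f => rfl
  | succ k ih => rw [pow_succ, pow_succ]; exact ih.comp h

lemma Extends.sum {ι : Type*} (s : Finset ι) {φ : ι → Module.End ℝ (MvPolynomial (Fin n) ℝ)}
    {ψ : ι → Module.End K (MvPolynomial (Fin n) K)} (h : ∀ i, Extends (φ i) (ψ i)) :
    Extends (∑ i ∈ s, φ i) (∑ i ∈ s, ψ i) := fun f => by
  simp only [LinearMap.sum_apply, map_sum, h _ _]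

lemma extends_del (i : Fin n) : Extends (del ℝ i) (del K i) := fun f => by
  simp [del, pderiv_map]

lemma extends_mulX (i : Fin n) : Extends (mulX ℝ i) (mulX K i) := fun f => by
  simp [mulX]

/-- The `ℝ(q)`-linear extension of a real operator. -/
def extendOp (φ : Module.End ℝ (MvPolynomial (Fin n) ℝ)) :
    Module.End K (MvPolynomial (Fin n) K) :=
  (basisMonomials (Fin n) K).constr K fun a => map (algebraMap ℝ K) (φ (monomial a 1))

lemma extends_extendOp (φ : Module.End ℝ (MvPolynomial (Fin n) ℝ)) :
    Extends φ (extendOp φ) := by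
  intro f
  induction f using MvPolynomial.induction_on' with
  | monomial a r =>
    have h1 : monomial a r = r • (monomial a 1 : MvPolynomial (Fin n) ℝ) := by
      rw [smul_monomial, smul_eq_mul, mul_one]
    have h2 : map (algebraMap ℝ K) (monomial a r) =
        algebraMap ℝ K r • basisMonomials (Fin n) K a := by
      rw [map_monomial, coe_basisMonomials, smul_monomial, smul_eq_mul, mul_one]
    rw [h2, map_smul, extendOp, Module.Basis.constr_basis, h1, map_smul, smul_eq_C_mul,
      smul_eq_C_mul, map_mul, map_C]
  | add f g hf hg => simp only [map_add, hf, hg]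

/-- The real polynomials contain the monomial basis. -/
lemma hom_ext_of_real {M : Type*} [AddCommGroup M] [Module K M]
    {α β : MvPolynomial (Fin n) K →ₗ[K] M}
    (h : ∀ f, α (map (algebraMap ℝ K) f) = β (map (algebraMap ℝ K) f)) : α = β := by
  refine (basisMonomials (Fin n) K).ext fun a => ?_
  have := h (monomial a 1)
  rwa [map_monomial, map_one] at this

lemma Extends.commute {φ φ' : Module.End ℝ (MvPolynomial (Fin n) ℝ)}
    {ψ ψ' : Module.End K (MvPolynomial (Fin n) K)} (h : Extends φ ψ) (h' : Extends φ' ψ')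
    (hc : ∀ f, φ (φ' f) = φ' (φ f)) (f) : ψ (ψ' f) = ψ' (ψ f) := by
  have : ψ ∘ₗ ψ' = ψ' ∘ₗ ψ := hom_ext_of_real fun f => by
    simp only [LinearMap.comp_apply, h _, h' _, hc]
  exact LinearMap.congr_fun this f

lemma expand_map_C (b : Polynomial ℝ) : expand (n := n) RatFunc.X (b.map C) =
    C (algebraMap (Polynomial ℝ) K b) := by
  induction b using Polynomial.induction_on' with
  | add p q hp hq => simp only [Polynomial.map_add, map_add, hp, hq]
  | monomial i r =>
    rw [Polynomial.map_monomial, expand_monomial, map_C, smul_eq_C_mul, ← C_mul,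
      ← Polynomial.C_mul_X_pow_eq_monomial, (algebraMap (Polynomial ℝ) K).map_mul,
      (algebraMap (Polynomial ℝ) K).map_pow, RatFunc.algebraMap_X, mul_comm]
    rfl

lemma map_real_smul (r : ℝ) (f : MvPolynomial (Fin n) ℝ) : map (algebraMap ℝ K) (r • f) =
    algebraMap ℝ K r • map (algebraMap ℝ K) f := by
  rw [smul_eq_C_mul, map_mul, map_C, ← smul_eq_C_mul]

/-- Clearing denominators. -/
lemma exists_expand_eq (f : MvPolynomial (Fin n) K) :
    ∃ b : Polynomial ℝ, b ≠ 0 ∧ ∃ Q, expand RatFunc.X Q = algebraMap (Polynomial ℝ) K b • f := by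
  induction f using MvPolynomial.induction_on with
  | C a =>
    refine ⟨a.denom, a.denom_ne_zero, a.num.map C, ?_⟩
    rw [expand_map_C, smul_eq_C_mul, ← C_mul]
    congr 1
    conv_rhs => rw [← RatFunc.num_div_denom a]
    rw [RatFunc.num_div_denom, mul_comm, eq_comm, ← eq_div_iff, RatFunc.num_div_denom]
    exact RatFunc.algebraMap_ne_zero a.denom_ne_zero
  | add f g hf hg =>
    obtain ⟨b, hb0, Q, hQ⟩ := hf
    obtain ⟨b', hb0', Q', hQ'⟩ := hg
    refine ⟨b * b', mul_ne_zero hb0 hb0', b'.map C * Q + b.map C * Q', ?_⟩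
    rw [map_add, map_mul, map_mul, hQ, hQ', expand_map_C, expand_map_C, ← smul_eq_C_mul, ← smul_eq_C_mul, map_mul,
      smul_add, smul_smul, smul_smul, mul_comm]
  | mul_X f i hf =>
    obtain ⟨b, hb0, Q, hQ⟩ := hf
    refine ⟨b, hb0, Q * Polynomial.C (X i), ?_⟩
    rw [map_mul, hQ, expand_C, map_X, smul_mul_assoc]

/-! ### Graded equivariant operators -/

section Graded

variable {F : Type*} [Field F]

lemma homogeneousComponent_comm_of_isHomogeneous (φ : Module.End F (MvPolynomial (Fin n) F))
    (h : ∀ d f, f.IsHomogeneous d → (φ f).IsHomogeneous d) (d : ℕ) (f : MvPolynomial (Fin n) F) :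
    homogeneousComponent d (φ f) = φ (homogeneousComponent d f) := by
  conv_lhs => rw [← sum_homogeneousComponent f]
  have h2 : ∀ i, homogeneousComponent d (φ (homogeneousComponent i f)) =
      if i = d then φ (homogeneousComponent d f) else 0 := by
    intro i
    rw [homogeneousComponent_of_mem (h i _ (homogeneousComponent_isHomogeneous i f))]
    split_ifs with h1 h2 h2
    · rw [h1]
    · exact absurd h1.symm h2
    · exact absurd h2.symm h1
    · rfl
  simp only [map_sum, h2, Finset.sum_ite_eq', Finset.mem_range]
  split_ifs with hd
  · rfl
  · rw [homogeneousComponent_eq_zero _ _ (by omega), map_zero]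

lemma homogeneousComponent_permRep (s : Equiv.Perm (Fin n)) (d : ℕ) (f : MvPolynomial (Fin n) F) :
    homogeneousComponent d (permRep F n s f) = permRep F n s (homogeneousComponent d f) :=
  homogeneousComponent_comm_of_isHomogeneous _ (fun _ _ h => h.rename_isHomogeneous) d f

lemma mem_of_homogeneousComponent_mem (U : Submodule F (MvPolynomial (Fin n) F))
    {f : MvPolynomial (Fin n) F} (h : ∀ d, homogeneousComponent d f ∈ U) : f ∈ U := by
  rw [← sum_homogeneousComponent f]
  exact Submodule.sum_mem _ fun i _ => h i

/-- The operator that acts as `α d` in degree `d`. -/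
def glue (α : ℕ → Module.End F (MvPolynomial (Fin n) F)) : Module.End F (MvPolynomial (Fin n) F) :=
  (basisMonomials (Fin n) F).constr F fun a => α a.degree (monomial a 1)

lemma glue_apply (α : ℕ → Module.End F (MvPolynomial (Fin n) F)) {d : ℕ}
    {f : MvPolynomial (Fin n) F} (hf : f.IsHomogeneous d) : glue α f = α d f := by
  have h1 : f = ∑ a ∈ f.support, f.coeff a • basisMonomials (Fin n) F a := by
    conv_lhs => rw [f.as_sum]
    refine Finset.sum_congr rfl fun a _ => ?_
    rw [coe_basisMonomials, smul_monomial, smul_eq_mul, mul_one]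
  rw [h1, map_sum, map_sum]
  refine Finset.sum_congr rfl fun a ha => ?_
  have hd : a.degree = d := by
    by_contra hne
    exact mem_support_iff.1 ha (hf.coeff_eq_zero hne)
  rw [map_smul, map_smul, glue, Module.Basis.constr_basis, hd, coe_basisMonomials]

/-- Isomorphisms are obtained by restricting operators on the whole polynomial ring, since these can
be averaged, glued and extended to `ℝ(q)`. -/
lemma subIso_of_operator {U W : Subrepresentation (permRep F n)}
    (φ : Module.End F (MvPolynomial (Fin n) F))
    (hperm : ∀ s, ∀ f ∈ U.toSubmodule, φ (permRep F n s f) = permRep F n s (φ f))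
    (hdeg : ∀ d, ∀ f ∈ U.toSubmodule, homogeneousComponent d (φ f) = φ (homogeneousComponent d f))
    (hU : IsGraded U) (hinj : ∀ f ∈ U.toSubmodule, φ f = 0 → f = 0)
    (himg : U.toSubmodule.map φ = W.toSubmodule) : SubIso U W := by
  have hmem : ∀ f ∈ U.toSubmodule, φ f ∈ W.toSubmodule := fun f hf => by
    rw [← himg]; exact Submodule.mem_map_of_mem hf
  let e : U.toSubmodule ≃ₗ[F] W.toSubmodule := LinearEquiv.ofBijective (φ.restrict hmem) (by
    constructor
    · rw [injective_iff_map_eq_zero]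
      intro f hf
      exact Subtype.ext (hinj _ f.2 (congrArg Subtype.val hf))
    · rintro ⟨g, hg⟩
      rw [← himg] at hg
      obtain ⟨f, hf, rfl⟩ := hg
      exact ⟨⟨f, hf⟩, rfl⟩)
  refine ⟨e, fun s v => Subtype.ext (hperm s _ v.2), fun d => le_antisymm ?_ ?_⟩
  · rintro _ ⟨f, hf, rfl⟩
    have hf' : homogeneousComponent d (f : MvPolynomial (Fin n) F) = f :=
      homogeneousComponent_eq_self hf
    have : homogeneousComponent d (φ f) = φ f := by rw [hdeg d _ f.2, hf']
    change φ f ∈ homogeneousSubmodule (Fin n) F d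
    rw [← this]
    exact homogeneousComponent_mem d _
  · intro g hg
    obtain ⟨f, rfl⟩ := e.surjective g
    have hg' : homogeneousComponent d (φ f) = φ f := homogeneousComponent_eq_self hg
    -- The degree `d` component of a preimage is again a preimage.
    refine ⟨⟨_, hU f f.2 d⟩, homogeneousComponent_mem d _, Subtype.ext ?_⟩
    change φ (homogeneousComponent d (f : MvPolynomial (Fin n) F)) = φ f
    rw [← hdeg d _ f.2, hg']

lemma gradedIso_symm {G V W : Type*} [Group G] [AddCommGroup V] [Module F V]
    [AddCommGroup W] [Module F W] {ρ : Representation F G V} {𝒱 : ℕ → Submodule F V}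
    {τ : Representation F G W} {𝒲 : ℕ → Submodule F W} (h : GradedIso ρ 𝒱 τ 𝒲) :
    GradedIso τ 𝒲 ρ 𝒱 := by
  obtain ⟨e, h1, h2⟩ := h
  refine ⟨e.symm, fun g v => ?_, fun d => ?_⟩
  · rw [e.symm_apply_eq, h1, e.apply_symm_apply]
  · rw [← h2 d, ← Submodule.map_comp]
    simp

lemma gradedIso_trans {G V W Z : Type*} [Group G] [AddCommGroup V] [Module F V]
    [AddCommGroup W] [Module F W] [AddCommGroup Z] [Module F Z]
    {ρ : Representation F G V} {𝒱 : ℕ → Submodule F V}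
    {τ : Representation F G W} {𝒲 : ℕ → Submodule F W}
    {σ : Representation F G Z} {𝒵 : ℕ → Submodule F Z}
    (h : GradedIso ρ 𝒱 τ 𝒲) (h' : GradedIso τ 𝒲 σ 𝒵) : GradedIso ρ 𝒱 σ 𝒵 := by
  obtain ⟨e, h1, h2⟩ := h
  obtain ⟨e', h1', h2'⟩ := h'
  refine ⟨e.trans e', fun g v => ?_, fun d => ?_⟩
  · simp only [LinearEquiv.trans_apply, h1, h1']
  · rw [LinearEquiv.coe_trans, Submodule.map_comp, h2, h2']

/-- A graded `Sₙ`-stable space of polynomials has an equivariant graded projection. -/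
lemma exists_equivariant_projection [CharZero F] {A : Subrepresentation (permRep F n)}
    (hA : IsGraded A) :
    ∃ π : Module.End F (MvPolynomial (Fin n) F), (∀ f, π f ∈ A.toSubmodule) ∧
      (∀ f ∈ A.toSubmodule, π f = f) ∧
      (∀ s f, π (permRep F n s f) = permRep F n s (π f)) ∧
      ∀ d f, homogeneousComponent d (π f) = π (homogeneousComponent d f) := by
  -- A linear projection is chosen separately in each degree, so that the glued map preserves
  -- degrees.
  have hg : ∀ d, ∃ g : MvPolynomial (Fin n) F →ₗ[F]
      (A.toSubmodule ⊓ homogeneousSubmodule (Fin n) F d : Submodule F _),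
      g ∘ₗ Submodule.subtype _ = LinearMap.id := fun d =>
    LinearMap.exists_leftInverse_of_injective _ (Submodule.ker_subtype _)
  choose g hg using hg
  let φ := glue fun d => Submodule.subtype _ ∘ₗ g d
  have hφ : ∀ {d f}, f.IsHomogeneous d → φ f = g d f := fun hf => glue_apply _ hf
  have hφh : ∀ d f, homogeneousComponent d (φ f) = φ (homogeneousComponent d f) :=
    homogeneousComponent_comm_of_isHomogeneous φ fun d f hf => by
      rw [hφ hf]; exact (g d f).2.2
  have hφA : ∀ f, φ f ∈ A.toSubmodule := fun f => mem_of_homogeneousComponent_mem _ fun d => by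
    rw [hφh, hφ (homogeneousComponent_isHomogeneous d f)]; exact (g d _).2.1
  have hφid : ∀ f ∈ A.toSubmodule, φ f = f := fun f hf => by
    have h1 : ∀ d, φ (homogeneousComponent d f) = homogeneousComponent d f := fun d => by
      rw [hφ (homogeneousComponent_isHomogeneous d f)]
      exact congrArg Subtype.val (LinearMap.congr_fun (hg d)
        ⟨_, hA f hf d, homogeneousComponent_mem d f⟩)
    conv_lhs => rw [← sum_homogeneousComponent f]
    rw [map_sum, Finset.sum_congr rfl fun d _ => h1 d, sum_homogeneousComponent]
  -- Maschke: average the conjugates of `φ` over the group.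
  refine ⟨(Fintype.card (Equiv.Perm (Fin n)) : F)⁻¹ •
    ∑ s, permRep F n s ∘ₗ φ ∘ₗ permRep F n s⁻¹, fun f => ?_, fun f hf => ?_, fun s f => ?_,
    fun d f => ?_⟩
  · rw [LinearMap.smul_apply, LinearMap.sum_apply]
    exact Submodule.smul_mem _ _ (Submodule.sum_mem _ fun s _ =>
      A.apply_mem_toSubmodule s (hφA _))
  · have h1 : ∀ s, (permRep F n s ∘ₗ φ ∘ₗ permRep F n s⁻¹) f = f := fun s => by
      rw [LinearMap.comp_apply, LinearMap.comp_apply, hφid _ (A.apply_mem_toSubmodule _ hf),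
        ← Module.End.mul_apply, ← map_mul, mul_inv_cancel, map_one, Module.End.one_apply]
    rw [LinearMap.smul_apply, LinearMap.sum_apply, Finset.sum_congr rfl fun s _ => h1 s,
      Finset.sum_const, Finset.card_univ, ← Nat.cast_smul_eq_nsmul F, smul_smul,
      inv_mul_cancel₀ (Nat.cast_ne_zero.2 Fintype.card_ne_zero), one_smul]
  · rw [LinearMap.smul_apply, LinearMap.smul_apply, map_smul, LinearMap.sum_apply,
      LinearMap.sum_apply, map_sum]
    congr 1
    rw [← Equiv.sum_comp (Equiv.mulLeft s)]
    refine Finset.sum_congr rfl fun t _ => ?_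
    simp only [LinearMap.comp_apply, Equiv.coe_mulLeft]
    rw [← Module.End.mul_apply (permRep F n (s * t)⁻¹), ← map_mul, map_mul (permRep F n) s t,
      Module.End.mul_apply]
    congr 4
    simp
  · simp only [LinearMap.smul_apply, LinearMap.sum_apply, map_smul, map_sum, LinearMap.comp_apply,
      homogeneousComponent_permRep, hφh]

end Graded

/-! ### Scalar extension, reduction, and the comparison between them -/

/-- The `ℝ(q)`-span of a space of real polynomials. -/
def scalarExt (A : Subrepresentation (permRep ℝ n)) : Subrepresentation (permRep K n) where
  toSubmodule := Submodule.span K (map (algebraMap ℝ K) '' A.toSubmodule)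
  apply_mem_toSubmodule s f hf := by
    have h : Submodule.span K (map (algebraMap ℝ K) '' A.toSubmodule) ≤
        (Submodule.span K (map (algebraMap ℝ K) '' A.toSubmodule)).comap (permRep K n s) := by
      rw [Submodule.span_le]
      rintro _ ⟨a, ha, rfl⟩
      exact Submodule.subset_span ⟨_, A.apply_mem_toSubmodule s ha, (extends_permRep s a).symm⟩
    exact h hf

lemma map_mem_scalarExt {A : Subrepresentation (permRep ℝ n)} {a : MvPolynomial (Fin n) ℝ}
    (ha : a ∈ A.toSubmodule) : map (algebraMap ℝ K) a ∈ (scalarExt A).toSubmodule :=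
  Submodule.subset_span ⟨a, ha, rfl⟩

lemma scalarExt_le {A : Subrepresentation (permRep ℝ n)}
    {W : Submodule K (MvPolynomial (Fin n) K)}
    (h : ∀ a ∈ A.toSubmodule, map (algebraMap ℝ K) a ∈ W) : (scalarExt A).toSubmodule ≤ W :=
  Submodule.span_le.2 (by rintro _ ⟨a, ha, rfl⟩; exact h a ha)

lemma isGraded_scalarExt {A : Subrepresentation (permRep ℝ n)} (hA : IsGraded A) :
    IsGraded (scalarExt A) := fun f hf d =>
  scalarExt_le (W := (scalarExt A).toSubmodule.comap (homogeneousComponent d)) (fun a ha => by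
    rw [Submodule.mem_comap, extends_homogeneousComponent]
    exact map_mem_scalarExt (hA a ha d)) hf

lemma extendOp_mem_scalarExt {A : Subrepresentation (permRep ℝ n)}
    {π : Module.End ℝ (MvPolynomial (Fin n) ℝ)} (hπ : ∀ f, π f ∈ A.toSubmodule)
    (f : MvPolynomial (Fin n) K) : extendOp π f ∈ (scalarExt A).toSubmodule := by
  have h : (scalarExt A).toSubmodule.mkQ ∘ₗ extendOp π = 0 := hom_ext_of_real fun f => by
    rw [LinearMap.comp_apply, extends_extendOp, LinearMap.zero_apply, Submodule.mkQ_apply,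
      Submodule.Quotient.mk_eq_zero]
    exact map_mem_scalarExt (hπ f)
  have := LinearMap.congr_fun h f
  rwa [LinearMap.comp_apply, LinearMap.zero_apply, Submodule.mkQ_apply,
    Submodule.Quotient.mk_eq_zero] at this

lemma extendOp_eq_self {A : Subrepresentation (permRep ℝ n)}
    {π : Module.End ℝ (MvPolynomial (Fin n) ℝ)} (hπ : ∀ f ∈ A.toSubmodule, π f = f)
    {f : MvPolynomial (Fin n) K} (hf : f ∈ (scalarExt A).toSubmodule) : extendOp π f = f :=
  scalarExt_le (W := LinearMap.eqLocus (extendOp π) LinearMap.id) (fun a ha => by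
    rw [LinearMap.mem_eqLocus, extends_extendOp, hπ a ha, LinearMap.id_apply]) hf

/-- The constant terms of the expansions in powers of `p` of elements of `U`. -/
def reduction (p : K) (U : Subrepresentation (permRep K n)) :
    Subrepresentation (permRep ℝ n) where
  toSubmodule :=
    { carrier := {g | ∃ Q, expand p Q ∈ U.toSubmodule ∧ Q.coeff 0 = g}
      add_mem' := by
        rintro _ _ ⟨Q, hQ, rfl⟩ ⟨Q', hQ', rfl⟩
        exact ⟨Q + Q', by rw [map_add]; exact add_mem hQ hQ', Polynomial.coeff_add _ _ _⟩
      zero_mem' := ⟨0, by rw [map_zero]; exact zero_mem _, Polynomial.coeff_zero _⟩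
      smul_mem' := by
        rintro r _ ⟨Q, hQ, rfl⟩
        refine ⟨Polynomial.C (C r) * Q, ?_, by rw [Polynomial.coeff_C_mul, smul_eq_C_mul]⟩
        rw [map_mul, expand_C, map_C, ← smul_eq_C_mul]
        exact Submodule.smul_mem _ _ hQ }
  apply_mem_toSubmodule s := by
    rintro _ ⟨Q, hQ, rfl⟩
    refine ⟨coeffMap (permRep ℝ n s) Q, ?_, coeff_coeffMap _ _ _⟩
    rw [← (extends_permRep s).expand]
    exact U.apply_mem_toSubmodule s hQ

lemma isGraded_reduction (p : K) {U : Subrepresentation (permRep K n)} (hU : IsGraded U) :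
    IsGraded (reduction p U) := by
  rintro _ ⟨Q, hQ, rfl⟩ d
  refine ⟨coeffMap (homogeneousComponent d) Q, ?_, coeff_coeffMap _ _ _⟩
  rw [← (extends_homogeneousComponent d).expand]
  exact hU _ hQ d

lemma finite_homogeneousSubmodule {F : Type*} [Field F] (d : ℕ) :
    Module.Finite F (homogeneousSubmodule (Fin n) F d) :=
  Module.Finite.iff_fg.2 (homogeneousSubmodule_fg (σ := Fin n) (R := F) d)

lemma finite_inf_homogeneousSubmodule {F : Type*} [Field F]
    (A : Submodule F (MvPolynomial (Fin n) F)) (d : ℕ) :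
    Module.Finite F (A ⊓ homogeneousSubmodule (Fin n) F d : Submodule F _) :=
  have := finite_homogeneousSubmodule (n := n) (F := F) d
  Submodule.finiteDimensional_of_le inf_le_right

/-- The span of elements whose coordinates have an invertible constant term. -/
lemma map_mem_of_expand_mem {p : K} (hp : Transcendental ℝ p)
    {B : Submodule ℝ (MvPolynomial (Fin n) ℝ)} [Module.Finite ℝ B]
    {W : Submodule K (MvPolynomial (Fin n) K)}
    (h : ∀ a ∈ B, ∃ Q, expand p Q ∈ W ∧ Q.coeff 0 = a ∧ ∀ i, Q.coeff i ∈ B) :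
    ∀ a ∈ B, map (algebraMap ℝ K) a ∈ W := by
  let b := Module.finBasis ℝ B
  choose Q hQW hQ0 hQB using fun j => h (b j) (b j).2
  -- Column `j` holds the coordinates of `Q j` in the basis `b`, as polynomials in an indeterminate
  -- standing for `p`.
  let M : Matrix (Fin (Module.finrank ℝ B)) (Fin (Module.finrank ℝ B)) (Polynomial ℝ) :=
    fun l j => ∑ i ∈ Finset.range ((Q j).natDegree + 1),
      Polynomial.monomial i (b.repr ⟨(Q j).coeff i, hQB j i⟩ l)
  have hsum : ∀ x : B, (x : MvPolynomial (Fin n) ℝ) = ∑ l, b.repr x l • (b l : MvPolynomial _ ℝ) :=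
    fun x => by
      conv_lhs => rw [← b.sum_repr x]
      simp only [AddSubmonoidClass.coe_finsetSum, Submodule.coe_smul]
  have hexp : ∀ j, expand p (Q j) =
      ∑ l, Polynomial.aeval p (M l j) • map (algebraMap ℝ K) (b l : MvPolynomial _ ℝ) := by
    intro j
    have h1 : ∀ i, map (algebraMap ℝ K) ((Q j).coeff i) = ∑ l, algebraMap ℝ K
        (b.repr ⟨(Q j).coeff i, hQB j i⟩ l) • map (algebraMap ℝ K) (b l : MvPolynomial _ ℝ) := by
      intro i
      conv_lhs => rw [show (Q j).coeff i = ((⟨(Q j).coeff i, hQB j i⟩ : B) : MvPolynomial _ ℝ)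
        from rfl, hsum]
      simp only [map_sum, map_real_smul]
    rw [expand_eq_sum p _ (Nat.lt_succ_self _)]
    simp only [h1, M, map_sum, Polynomial.aeval_monomial, Finset.sum_smul, Finset.smul_sum]
    rw [Finset.sum_comm]
    simp only [smul_smul, mul_comm]
  -- The constant term of `Q j` is `b j`, so `det M` takes the value 1 at 0 and is a nonzero
  -- polynomial; transcendence of `p` keeps it nonzero after substitution.
  have hM0 : M.map (Polynomial.evalRingHom 0) = 1 := by
    ext l j
    have h0 : (⟨(Q j).coeff 0, hQB j 0⟩ : B) = b j := Subtype.ext (hQ0 j)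
    rw [Matrix.map_apply, Polynomial.coe_evalRingHom, ← Polynomial.coeff_zero_eq_eval_zero]
    simp only [M, Polynomial.finsetSum_coeff, Polynomial.coeff_monomial, Finset.sum_ite_eq',
      Finset.mem_range, Nat.zero_lt_succ, if_true, h0, Module.Basis.repr_self]
    rw [Matrix.one_apply, Finsupp.single_apply]
    simp only [eq_comm]
  have hdet : M.det ≠ 0 := fun h0 => by
    have h1 := (Polynomial.evalRingHom (0 : ℝ)).map_det M
    rw [RingHom.mapMatrix_apply, hM0, h0, Matrix.det_one, map_zero] at h1
    exact zero_ne_one h1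
  let N := M.map (Polynomial.aeval p).toRingHom
  have hN : IsUnit N.det := by
    have h1 := (Polynomial.aeval p).toRingHom.map_det M
    rw [RingHom.mapMatrix_apply] at h1
    rw [← h1, isUnit_iff_ne_zero]
    exact fun h0 => hdet ((transcendental_iff.1 hp) _ h0)
  have hb : ∀ l, map (algebraMap ℝ K) (b l : MvPolynomial _ ℝ) ∈ W := by
    intro l
    have h1 : map (algebraMap ℝ K) (b l : MvPolynomial _ ℝ) =
        ∑ j, N⁻¹ j l • expand p (Q j) := by
      simp only [hexp, Finset.smul_sum]
      rw [Finset.sum_comm]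
      have h2 : ∀ l', ∑ j, N⁻¹ j l • Polynomial.aeval p (M l' j) •
          map (algebraMap ℝ K) (b l' : MvPolynomial (Fin n) ℝ) =
          (1 : Matrix _ _ K) l' l • map (algebraMap ℝ K) (b l' : MvPolynomial (Fin n) ℝ) := by
        intro l'
        rw [← Matrix.mul_nonsing_inv N hN, Matrix.mul_apply, Finset.sum_smul]
        exact Finset.sum_congr rfl fun j _ => by rw [smul_smul, mul_comm]; rfl
      simp only [h2, Matrix.one_apply, ite_smul, one_smul, zero_smul, Finset.sum_ite_eq',
        Finset.mem_univ, if_true]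
    rw [h1]
    exact Submodule.sum_mem _ fun j _ => Submodule.smul_mem _ _ (hQW j)
  intro a ha
  rw [show a = ((⟨a, ha⟩ : B) : MvPolynomial _ ℝ) from rfl, hsum, map_sum]
  exact Submodule.sum_mem _ fun l _ => by rw [map_real_smul]; exact Submodule.smul_mem _ _ (hb l)

/-- The hypothesis `h` is the normalization that makes the projection injective on `U`: it moves a
nonzero constant term into view. -/
lemma subIso_scalarExt_reduction {p : K} (hp : Transcendental ℝ p)
    {U : Subrepresentation (permRep K n)} (hU : IsGraded U)
    (h : ∀ f ∈ U.toSubmodule, f ≠ 0 → ∃ k : K, ∃ Q, expand p Q = k • f ∧ Q.coeff 0 ≠ 0) :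
    SubIso U (scalarExt (reduction p U)) := by
  obtain ⟨π, hπA, hπid, hπperm, hπdeg⟩ := exists_equivariant_projection (isGraded_reduction p hU)
  have hdeg : ∀ d f, homogeneousComponent d (extendOp π f) =
      extendOp π (homogeneousComponent d f) :=
    fun d => (extends_homogeneousComponent d).commute (extends_extendOp π) (hπdeg d)
  refine subIso_of_operator (extendOp π)
    (fun s f _ => (extends_extendOp π).commute (extends_permRep s) (hπperm s) f)
    (fun d f _ => hdeg d f) hU ?_ (le_antisymm ?_ ?_)
  · intro f hf hf0
    -- If `π` killed `f`, it would kill the constant term of a multiple of `f`; but that term is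
    -- nonzero and fixed by `π`.
    by_contra hne
    obtain ⟨k, Q, hQ, hQ0⟩ := h f hf hne
    have h1 : expand p (coeffMap π Q) = expand p 0 := by
      rw [← (extends_extendOp π).expand, hQ, map_smul, hf0, smul_zero, map_zero]
    have h2 := congrArg (fun P => Polynomial.coeff P 0) (expand_injective hp h1)
    simp only [coeff_coeffMap, Polynomial.coeff_zero] at h2
    have h3 : expand p Q ∈ U.toSubmodule := by
      rw [hQ]; exact Submodule.smul_mem _ _ hf
    exact hQ0 (by rwa [hπid _ ⟨Q, h3, rfl⟩] at h2)
  · rintro _ ⟨f, -, rfl⟩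
    exact extendOp_mem_scalarExt hπA f
  · refine scalarExt_le fun a ha => mem_of_homogeneousComponent_mem _ fun d => ?_
    rw [extends_homogeneousComponent]
    have := finite_inf_homogeneousSubmodule (reduction p U).toSubmodule d
    refine map_mem_of_expand_mem hp
      (B := (reduction p U).toSubmodule ⊓ homogeneousSubmodule (Fin n) ℝ d) ?_ _
      ⟨isGraded_reduction p hU a ha d, homogeneousComponent_mem d a⟩
    rintro a ⟨ha, had⟩
    obtain ⟨Q, hQU, rfl⟩ := id ha
    -- Projecting the lift keeps its constant term and moves every other coefficient into the degree
    -- `d` part of the reduction, as `map_mem_of_expand_mem` requires.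
    refine ⟨coeffMap (π * homogeneousComponent d) Q, ?_, ?_, fun i => ?_⟩
    · rw [← ((extends_extendOp π).comp (extends_homogeneousComponent d)).expand]
      exact ⟨_, hU _ hQU d, rfl⟩
    · rw [coeff_coeffMap, Module.End.mul_apply, homogeneousComponent_eq_self had, hπid _ ha]
    · rw [coeff_coeffMap, Module.End.mul_apply]
      refine ⟨hπA _, ?_⟩
      rw [← hπdeg]
      exact homogeneousComponent_mem d _

/-! ### First and last terms as reductions at `q` and `q⁻¹` -/

lemma exists_expand_inv_eq {p : K} (hp : p ≠ 0) {f : MvPolynomial (Fin n) K}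
    {Q : Polynomial (MvPolynomial (Fin n) ℝ)} {k : K} (hQ : expand p Q = k • f) (hQ0 : Q ≠ 0) :
    ∃ k' : K, ∃ Q', expand p⁻¹ Q' = k' • f ∧ Q'.coeff 0 ≠ 0 := by
  refine ⟨(p ^ Q.natDegree)⁻¹ * k, Q.reverse, ?_, ?_⟩
  · rw [mul_smul, ← hQ, ← expand_reverse hp, mul_comm, ← smul_eq_C_mul, smul_smul,
      inv_mul_cancel₀ (pow_ne_zero _ hp), one_smul]
  · rw [Polynomial.coeff_zero_reverse]
    exact Polynomial.leadingCoeff_ne_zero.2 hQ0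

lemma exists_expand_q_inv {f : MvPolynomial (Fin n) K} (hf : f ≠ 0) :
    ∃ k : K, ∃ Q, expand (RatFunc.X : K)⁻¹ Q = k • f ∧ Q.coeff 0 ≠ 0 := by
  obtain ⟨b, hb, Q, hQ⟩ := exists_expand_eq f
  refine exists_expand_inv_eq RatFunc.X_ne_zero hQ ?_
  rintro rfl
  rw [map_zero, eq_comm, smul_eq_zero] at hQ
  exact hQ.elim (RatFunc.algebraMap_ne_zero hb) hf

/-- Reversing twice strips the powers of the indeterminate that divide an expansion. -/
lemma exists_expand_q {f : MvPolynomial (Fin n) K} (hf : f ≠ 0) :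
    ∃ k : K, ∃ Q, expand (RatFunc.X : K) Q = k • f ∧ Q.coeff 0 ≠ 0 := by
  obtain ⟨k, Q, hQ, hQ0⟩ := exists_expand_q_inv hf
  have := exists_expand_inv_eq (inv_ne_zero RatFunc.X_ne_zero) hQ
    (by rintro rfl; exact hQ0 (Polynomial.coeff_zero 0))
  rwa [inv_inv] at this

/-- The polynomial `∑ T^i cᵢ`, `i ≤ m`. -/
lemma expand_sum_monomial (p : K) (m : ℕ) (c : ℕ → MvPolynomial (Fin n) ℝ) :
    expand p (∑ i ∈ Finset.range (m + 1), Polynomial.monomial i (c i)) =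
      ∑ i ∈ Finset.range (m + 1), C (p ^ i) * map (algebraMap ℝ K) (c i) := by
  simp only [map_sum, expand_monomial, smul_eq_C_mul]

lemma isQExpansion_expand {Q : Polynomial (MvPolynomial (Fin n) ℝ)} (hQ : Q.coeff 0 ≠ 0) :
    IsQExpansion (expand RatFunc.X Q) 0 Q.natDegree Q.coeff := by
  refine ⟨hQ, fun h => hQ ?_, ?_⟩
  · rw [Polynomial.coeff_natDegree, Polynomial.leadingCoeff_eq_zero] at h
    rw [h, Polynomial.coeff_zero]
  · rw [zpow_zero, C_1, one_mul, ← expand_sum_monomial, ← Q.as_sum_range]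

/-- The factor `q ^ r` is a unit of `ℝ(q)`, so it can be dropped. Together with 0, the first terms
already form a subspace. -/
lemma firstTermSpan_eq_reduction (n : ℕ) :
    firstTermSpan n = reduction RatFunc.X (qHarmonics n) := by
  ext1
  refine le_antisymm (Submodule.span_le.2 ?_) ?_
  · rintro _ ⟨f, hf, r, m, c, ⟨-, -, h⟩, rfl⟩
    refine ⟨∑ i ∈ Finset.range (m + 1), Polynomial.monomial i (c i), ?_, ?_⟩
    · have h1 : expand RatFunc.X (∑ i ∈ Finset.range (m + 1), Polynomial.monomial i (c i)) =
          ((RatFunc.X : K) ^ r)⁻¹ • f := by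
        rw [expand_sum_monomial, h, ← smul_eq_C_mul, smul_smul,
          inv_mul_cancel₀ (zpow_ne_zero _ RatFunc.X_ne_zero), one_smul]
      rw [h1]
      exact Submodule.smul_mem _ _ hf
    · simp [Polynomial.finsetSum_coeff, Polynomial.coeff_monomial]
  · rintro _ ⟨Q, hQ, rfl⟩
    by_cases h0 : Q.coeff 0 = 0
    · rw [h0]; exact zero_mem _
    · exact Submodule.subset_span ⟨_, hQ, 0, _, _, isQExpansion_expand h0, rfl⟩

lemma lastTermSpan_eq_reduction (n : ℕ) :
    lastTermSpan n = reduction (RatFunc.X : K)⁻¹ (qHarmonics n) := by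
  ext1
  refine le_antisymm (Submodule.span_le.2 ?_) ?_
  · rintro _ ⟨f, hf, r, m, c, ⟨-, hm, h⟩, rfl⟩
    let Q := ∑ i ∈ Finset.range (m + 1), Polynomial.monomial i (c i)
    have hc : ∀ j, Q.coeff j = if j ∈ Finset.range (m + 1) then c j else 0 := fun j => by
      simp only [Q, Polynomial.finsetSum_coeff, Polynomial.coeff_monomial, Finset.sum_ite_eq']
    have hd : Q.natDegree = m := by
      refine Polynomial.natDegree_eq_of_le_of_coeff_ne_zero ?_ ?_
      · refine Polynomial.natDegree_le_iff_coeff_eq_zero.2 fun j hj => ?_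
        rw [hc, if_neg (by rw [Finset.mem_range]; omega)]
      · rw [hc, if_pos (by simp)]; exact hm
    refine ⟨Q.reverse, ?_, ?_⟩
    · have h1 : expand (RatFunc.X : K)⁻¹ Q.reverse =
          ((RatFunc.X : K) ^ Q.natDegree)⁻¹ • ((RatFunc.X : K) ^ r)⁻¹ • f := by
        rw [h, ← expand_sum_monomial, ← smul_eq_C_mul, smul_smul ((RatFunc.X : K) ^ r)⁻¹,
          inv_mul_cancel₀ (zpow_ne_zero _ RatFunc.X_ne_zero), one_smul,
          ← expand_reverse RatFunc.X_ne_zero, mul_comm, ← smul_eq_C_mul, smul_smul,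
          inv_mul_cancel₀ (pow_ne_zero _ RatFunc.X_ne_zero), one_smul]
      rw [h1]
      exact Submodule.smul_mem _ _ (Submodule.smul_mem _ _ hf)
    · rw [Polynomial.coeff_zero_reverse, Polynomial.leadingCoeff, hd, hc, if_pos (by simp)]
  · rintro _ ⟨Q, hQ, rfl⟩
    by_cases h0 : Q.coeff 0 = 0
    · rw [h0]; exact zero_mem _
    have hQ0 : Q ≠ 0 := by rintro rfl; exact h0 (Polynomial.coeff_zero 0)
    have h1 : expand RatFunc.X Q.reverse =
        ((RatFunc.X : K)⁻¹ ^ Q.natDegree)⁻¹ • expand (RatFunc.X : K)⁻¹ Q := by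
      have := expand_reverse (inv_ne_zero RatFunc.X_ne_zero) Q
      rw [inv_inv] at this
      rw [← this, mul_comm, ← smul_eq_C_mul, smul_smul,
        inv_mul_cancel₀ (pow_ne_zero _ (inv_ne_zero RatFunc.X_ne_zero)), one_smul]
    have h2 : Q.reverse.coeff 0 ≠ 0 := by
      rw [Polynomial.coeff_zero_reverse]
      exact Polynomial.leadingCoeff_ne_zero.2 hQ0
    refine Submodule.subset_span ⟨_, ?_, 0, _, _, isQExpansion_expand h2, ?_⟩
    · rw [h1]
      exact Submodule.smul_mem _ _ hQ
    -- Since `Q` has nonzero constant term, that term is the leading coefficient of its reversal.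
    · have h3 := Polynomial.reverse_leadingCoeff Q
      rw [Polynomial.leadingCoeff, Polynomial.trailingCoeff,
        Polynomial.natTrailingDegree_eq_zero.2 (Or.inr h0)] at h3
      exact h3.symm

/-! ### The span over `ℝ(q)` as a tensor product -/

/-- The natural map `ℝ(q) ⊗ A → ℝ(q)[x]`. -/
def tensorMap (A : Subrepresentation (permRep ℝ n)) :
    K ⊗[ℝ] A.toSubmodule →ₗ[K] MvPolynomial (Fin n) K :=
  (algebraTensorAlgEquiv (σ := Fin n) ℝ K).toLinearMap ∘ₗ A.toSubmodule.subtype.baseChange K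

lemma tensorMap_tmul (A : Subrepresentation (permRep ℝ n)) (k : K) (a : A.toSubmodule) :
    tensorMap A (k ⊗ₜ a) = k • map (algebraMap ℝ K) (a : MvPolynomial (Fin n) ℝ) := by
  simp only [tensorMap, LinearMap.comp_apply, LinearMap.baseChange_tmul]
  exact algebraTensorAlgEquiv_tmul ..

lemma tensorMap_injective (A : Subrepresentation (permRep ℝ n)) :
    Function.Injective (tensorMap A) :=
  (algebraTensorAlgEquiv (σ := Fin n) ℝ K).injective.comp
    (Module.Flat.lTensor_preserves_injective_linearMap _ A.toSubmodule.injective_subtype)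

lemma range_tensorMap (A : Subrepresentation (permRep ℝ n)) :
    LinearMap.range (tensorMap A) = (scalarExt A).toSubmodule := by
  refine le_antisymm ?_ (scalarExt_le fun a ha => ⟨1 ⊗ₜ ⟨a, ha⟩, ?_⟩)
  · rintro _ ⟨v, rfl⟩
    induction v using TensorProduct.induction_on with
    | zero => rw [map_zero]; exact zero_mem _
    | tmul k a =>
      rw [tensorMap_tmul]
      exact Submodule.smul_mem _ _ (map_mem_scalarExt a.2)
    | add x y hx hy => rw [map_add]; exact add_mem hx hy
  · rw [tensorMap_tmul, one_smul]

lemma extIso_scalarExt {A : Subrepresentation (permRep ℝ n)} (hA : IsGraded A) :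
    ExtIso A (scalarExt A) := by
  let e : K ⊗[ℝ] A.toSubmodule ≃ₗ[K] (scalarExt A).toSubmodule :=
    (LinearEquiv.ofInjective _ (tensorMap_injective A)).trans
      (LinearEquiv.ofEq _ _ (range_tensorMap A))
  refine ⟨e, fun s v => Subtype.ext ?_, fun d => le_antisymm ?_ ?_⟩
  · change tensorMap A ((A.toRepresentation s).baseChange K v) = permRep K n s (tensorMap A v)
    induction v using TensorProduct.induction_on with
    | zero => simp only [map_zero]
    | tmul k a =>
      rw [LinearMap.baseChange_tmul, tensorMap_tmul, tensorMap_tmul, map_smul, extends_permRep]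
      rfl
    | add x y hx hy => simp only [map_add, hx, hy]
  · rw [Submodule.map_le_iff_le_comap]
    change (degPart A d).baseChange K ≤ _
    rw [Submodule.baseChange_eq_span, Submodule.span_le]
    rintro _ ⟨a, ha, rfl⟩
    change tensorMap A (1 ⊗ₜ a) ∈ homogeneousSubmodule (Fin n) K d
    rw [tensorMap_tmul, one_smul]
    exact IsHomogeneous.map (mem_homogeneousSubmodule _ _ |>.1 ha) _
  -- Taking components lifts to the tensor product, so a homogeneous element comes from the extended
  -- degree part.
  · have h : ∀ v, ∃ w ∈ (degPart A d).baseChange K,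
        tensorMap A w = homogeneousComponent d (tensorMap A v) := by
      intro v
      induction v using TensorProduct.induction_on with
      | zero => exact ⟨0, zero_mem _, by simp only [map_zero]⟩
      | tmul k a =>
        refine ⟨k ⊗ₜ ⟨_, hA a a.2 d⟩,
          Submodule.tmul_mem_baseChange_of_mem k (homogeneousComponent_mem d _), ?_⟩
        rw [tensorMap_tmul, tensorMap_tmul, map_smul, extends_homogeneousComponent]
      | add x y hx hy =>
        obtain ⟨w, hw, hw'⟩ := hx
        obtain ⟨z, hz, hz'⟩ := hy
        exact ⟨w + z, add_mem hw hz, by simp only [map_add, hw', hz']⟩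
    intro g hg
    obtain ⟨v, rfl⟩ := e.surjective g
    obtain ⟨w, hw, hw'⟩ := h v
    refine ⟨w, hw, Subtype.ext ?_⟩
    change tensorMap A w = tensorMap A v
    rw [hw']
    exact homogeneousComponent_eq_self hg

/-! ### Descent from `ℝ(q)` to `ℝ` by specialization -/

/-- In each degree, an `ℝ(q)`-linear operator is, up to a denominator, a real operator with
coefficients polynomial in `q`. -/
lemma exists_polynomial_family (θ : Module.End K (MvPolynomial (Fin n) K)) (d : ℕ) :
    ∃ b : Polynomial ℝ, b ≠ 0 ∧
      ∃ Θ : MvPolynomial (Fin n) ℝ →ₗ[ℝ] Polynomial (MvPolynomial (Fin n) ℝ),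
        ∀ f : MvPolynomial (Fin n) ℝ, f.IsHomogeneous d → expand RatFunc.X (Θ f) =
          algebraMap (Polynomial ℝ) K b • θ (map (algebraMap ℝ K) f) := by
  have := finite_homogeneousSubmodule (n := n) (F := ℝ) d
  let v := Module.finBasis ℝ (homogeneousSubmodule (Fin n) ℝ d)
  choose b hb Q hQ using fun j =>
    exists_expand_eq (θ (map (algebraMap ℝ K) (v j : MvPolynomial (Fin n) ℝ)))
  -- The product over `i ≠ j` brings the image of `v j` to the common denominator `∏ j, b j`. The
  -- extension `Θ` is arbitrary outside degree `d`.
  let Θ₀ := v.constr ℝ fun j => (∏ i ∈ Finset.univ.erase j, b i).map C * Q j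
  obtain ⟨Θ, hΘ⟩ := LinearMap.exists_extend Θ₀
  refine ⟨∏ j, b j, Finset.prod_ne_zero_iff.2 fun j _ => hb j, Θ, fun f hf => ?_⟩
  have h1 : Θ f = Θ₀ ⟨f, hf⟩ := LinearMap.congr_fun hΘ ⟨f, hf⟩
  have h2 : ∀ x, expand RatFunc.X (Θ₀ x) = algebraMap (Polynomial ℝ) K (∏ j, b j) •
      θ (map (algebraMap ℝ K) (x : MvPolynomial (Fin n) ℝ)) := by
    intro x
    have h3 : (x : MvPolynomial (Fin n) ℝ) = ∑ j, v.repr x j • (v j : MvPolynomial (Fin n) ℝ) := by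
      conv_lhs => rw [← v.sum_repr x]
      simp only [AddSubmonoidClass.coe_finsetSum, Submodule.coe_smul]
    have h4 : Θ₀ x = ∑ j, Polynomial.C (C (v.repr x j)) *
        ((∏ i ∈ Finset.univ.erase j, b i).map C * Q j) := by
      rw [Module.Basis.constr_apply_fintype]
      refine Finset.sum_congr rfl fun j _ => ?_
      ext1 i
      rw [Polynomial.coeff_C_mul, Polynomial.coeff_smul, smul_eq_C_mul]
      rfl
    rw [h3, h4]
    simp only [map_sum, map_real_smul, map_smul, Finset.smul_sum]
    refine Finset.sum_congr rfl fun j _ => ?_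
    rw [map_mul, map_mul, expand_C, expand_map_C, hQ, map_C, ← smul_eq_C_mul, ← smul_eq_C_mul,
      smul_smul (algebraMap (Polynomial ℝ) K _), ← map_mul, Finset.prod_erase_mul _ _
      (Finset.mem_univ j), smul_comm]
  rw [h1, h2]

lemma eval_coeffMap (φ : Module.End ℝ (MvPolynomial (Fin n) ℝ)) (t : ℝ)
    (Q : Polynomial (MvPolynomial (Fin n) ℝ)) :
    (coeffMap φ Q).eval (C t) = φ (Q.eval (C t)) := by
  rw [coeffMap, Polynomial.eval_finsetSum, Polynomial.eval_eq_sum_range, map_sum]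
  refine Finset.sum_congr rfl fun i _ => ?_
  rw [Polynomial.eval_monomial, ← C_pow, mul_comm, ← smul_eq_C_mul, mul_comm, ← smul_eq_C_mul,
    map_smul]

lemma Extends.coeffMap_eq {φ : Module.End ℝ (MvPolynomial (Fin n) ℝ)}
    {ψ : Module.End K (MvPolynomial (Fin n) K)} (h : Extends φ ψ) {p : K}
    (hp : Transcendental ℝ p) {Q Q' : Polynomial (MvPolynomial (Fin n) ℝ)}
    (hQ : ψ (QHarm.expand p Q) = QHarm.expand p Q') : coeffMap φ Q = Q' :=
  expand_injective hp (by rw [← h.expand, hQ])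

/-- Specialization of the identity `θ' θ = 1`. -/
lemma eval_eval_polynomial_family {θ θ' : Module.End K (MvPolynomial (Fin n) K)} {d : ℕ}
    {b b' : Polynomial ℝ}
    {Θ Θ' : MvPolynomial (Fin n) ℝ →ₗ[ℝ] Polynomial (MvPolynomial (Fin n) ℝ)}
    (hΘ : ∀ f : MvPolynomial (Fin n) ℝ, f.IsHomogeneous d → expand RatFunc.X (Θ f) =
      algebraMap (Polynomial ℝ) K b • θ (map (algebraMap ℝ K) f))
    (hΘ' : ∀ f : MvPolynomial (Fin n) ℝ, f.IsHomogeneous d → expand RatFunc.X (Θ' f) =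
      algebraMap (Polynomial ℝ) K b' • θ' (map (algebraMap ℝ K) f))
    {f : MvPolynomial (Fin n) ℝ} (hf : f.IsHomogeneous d)
    (hcoeff : ∀ i, ((Θ f).coeff i).IsHomogeneous d)
    (hinv : θ' (θ (map (algebraMap ℝ K) f)) = map (algebraMap ℝ K) f) (t : ℝ) :
    (Θ' ((Θ f).eval (C t))).eval (C t) = (b'.eval t * b.eval t) • f := by
  -- `S` is `Θ'` applied to the coefficients of `Θ f`; its value at `t` is the left side of the
  -- goal.
  let S := ∑ i ∈ Finset.range ((Θ f).natDegree + 1),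
    Polynomial.X ^ i * Θ' ((Θ f).coeff i)
  have h1 : expand RatFunc.X S = expand RatFunc.X ((b' * b).map C * Polynomial.C f) := by
    have h2 : expand RatFunc.X S = algebraMap (Polynomial ℝ) K b' •
        θ' (expand RatFunc.X (Θ f)) := by
      rw [expand_eq_sum _ (Θ f) (Nat.lt_succ_self _)]
      simp only [S, map_sum, map_mul, map_pow, expand_X, map_smul, Finset.smul_sum]
      refine Finset.sum_congr rfl fun i _ => ?_
      rw [hΘ' _ (hcoeff i), ← C_pow, ← smul_eq_C_mul, smul_comm]
    rw [h2, hΘ _ hf, map_smul, hinv, map_mul, expand_map_C, expand_C, ← smul_eq_C_mul, smul_smul,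
      map_mul]
  -- Injectivity turns the identity over `ℝ(q)` into one of polynomials, which may be evaluated at a
  -- real point.
  have h3 := congrArg (Polynomial.eval (C t)) (expand_injective transcendental_q h1)
  rw [Polynomial.eval_mul, Polynomial.eval_C, Polynomial.eval_map, Polynomial.eval₂_at_apply,
    Polynomial.eval_mul, ← smul_eq_C_mul] at h3
  rw [← h3, Polynomial.eval_finsetSum, Polynomial.eval_eq_sum_range (p := Θ f)]
  have h4 : ∀ Q : Polynomial (MvPolynomial (Fin n) ℝ), ∀ r : ℝ,
      (r • Q).eval (C t) = r • Q.eval (C t) := fun Q r => by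
    rw [← Polynomial.leval_apply, ← Polynomial.leval_apply,
      ← LinearMap.coe_restrictScalars ℝ, map_smul]
  have h5 : ∀ i, (Θ f).coeff i * C t ^ i = t ^ i • (Θ f).coeff i := fun i => by
    rw [← C_pow, mul_comm, ← smul_eq_C_mul]
  simp only [h5, map_sum, map_smul, Polynomial.eval_finsetSum, h4, Polynomial.eval_mul,
    Polynomial.eval_pow, Polynomial.eval_X]
  exact Finset.sum_congr rfl fun i _ => by rw [← C_pow, ← smul_eq_C_mul]

/-- A graded isomorphism of extended spaces is induced by an equivariant graded operator. -/
lemma exists_operator_of_gradedIso {A B : Subrepresentation (permRep ℝ n)}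
    (hA : IsGraded A)
    (e : (scalarExt A).toSubmodule ≃ₗ[K] (scalarExt B).toSubmodule)
    (he : ∀ s v, e ((scalarExt A).toRepresentation s v) = (scalarExt B).toRepresentation s (e v))
    (hd : ∀ d, (degPart (scalarExt A) d).map (e : _ →ₗ[K] (scalarExt B).toSubmodule) =
      degPart (scalarExt B) d) :
    ∃ θ : Module.End K (MvPolynomial (Fin n) K),
      (∀ v : (scalarExt A).toSubmodule, θ v = e v) ∧
      (∀ f, θ f ∈ (scalarExt B).toSubmodule) ∧
      (∀ s f, θ (permRep K n s f) = permRep K n s (θ f)) ∧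
      ∀ d f, homogeneousComponent d (θ f) = θ (homogeneousComponent d f) := by
  obtain ⟨π, hπA, hπid, hπperm, hπdeg⟩ := exists_equivariant_projection hA
  -- Precomposing with a projection onto the source extends `e` to the whole polynomial ring.
  let ρ := LinearMap.codRestrict (scalarExt A).toSubmodule (extendOp π) (extendOp_mem_scalarExt hπA)
  refine ⟨(scalarExt B).toSubmodule.subtype ∘ₗ e.toLinearMap ∘ₗ ρ, fun v => ?_, fun f => ?_,
    fun s f => ?_, homogeneousComponent_comm_of_isHomogeneous _ fun d f hf => ?_⟩
  · have h : ρ v = v := Subtype.ext (extendOp_eq_self hπid v.2)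
    simp only [LinearMap.comp_apply, h]
    rfl
  · exact (e (ρ f)).2
  · have h : ρ (permRep K n s f) = (scalarExt A).toRepresentation s (ρ f) :=
      Subtype.ext ((extends_extendOp π).commute (extends_permRep s) (hπperm s) f)
    simp only [LinearMap.comp_apply, h, LinearEquiv.coe_coe, he]
    rfl
  · have h1 : ρ f ∈ degPart (scalarExt A) d := by
      have h2 := (extends_homogeneousComponent d).commute (extends_extendOp π) (hπdeg d) f
      rw [homogeneousComponent_eq_self hf] at h2
      change extendOp π f ∈ homogeneousSubmodule (Fin n) K d
      rw [← h2]
      exact homogeneousComponent_mem d _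
    have h3 : e (ρ f) ∈ degPart (scalarExt B) d := by
      rw [← hd d]; exact Submodule.mem_map_of_mem h1
    exact h3

/-- Real graded representations that become isomorphic over `ℝ(q)` are isomorphic. -/
lemma subIso_of_subIso_scalarExt {A B : Subrepresentation (permRep ℝ n)}
    (hA : IsGraded A) (hB : IsGraded B) (h : SubIso (scalarExt A) (scalarExt B)) :
    SubIso A B := by
  obtain ⟨e, he, hd⟩ := h
  obtain ⟨e', he', hd'⟩ : ∃ e' : (scalarExt B).toSubmodule ≃ₗ[K] (scalarExt A).toSubmodule,
      (∀ s v, e' ((scalarExt B).toRepresentation s v) =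
        (scalarExt A).toRepresentation s (e' v)) ∧
      (∀ d, (degPart (scalarExt B) d).map (e' : _ →ₗ[K] (scalarExt A).toSubmodule) =
        degPart (scalarExt A) d) ∧ e' = e.symm := by
    refine ⟨e.symm, fun s v => ?_, fun d => ?_, rfl⟩
    · rw [e.symm_apply_eq, he, e.apply_symm_apply]
    · rw [← hd d, ← Submodule.map_comp]
      simp
  obtain ⟨hd', rfl⟩ := hd'
  obtain ⟨θ, hθe, hθB, hθp, hθd⟩ := exists_operator_of_gradedIso hA e he hd
  obtain ⟨θ', hθe', hθA', hθp', hθd'⟩ := exists_operator_of_gradedIso hB e.symm he' hd'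
  have hinv : ∀ f ∈ A.toSubmodule, θ' (θ (map (algebraMap ℝ K) f)) = map (algebraMap ℝ K) f :=
    fun f hf => by
      rw [hθe ⟨_, map_mem_scalarExt hf⟩, hθe', e.symm_apply_apply]
  have hinv' : ∀ f ∈ B.toSubmodule, θ (θ' (map (algebraMap ℝ K) f)) = map (algebraMap ℝ K) f :=
    fun f hf => by
      rw [hθe' ⟨_, map_mem_scalarExt hf⟩, hθe, e.apply_symm_apply]
  choose b hb Θ hΘ using exists_polynomial_family θ
  choose b' hb' Θ' hΘ' using exists_polynomial_family θ'
  -- The denominators vary with the degree, and so does the point of specialization; `glue`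
  -- reassembles the degrees.
  have ht : ∀ d, ∃ t : ℝ, (b' d * b d).eval t ≠ 0 := fun d => by
    by_contra! h0
    exact mul_ne_zero (hb' d) (hb d) (Polynomial.funext fun t => by rw [h0, Polynomial.eval_zero])
  choose t ht using ht
  have hcoeff : ∀ {θ : Module.End K (MvPolynomial (Fin n) K)} {d : ℕ} {b : Polynomial ℝ}
      {Q : Polynomial (MvPolynomial (Fin n) ℝ)} {f : MvPolynomial (Fin n) ℝ},
      (∀ d f, homogeneousComponent d (θ f) = θ (homogeneousComponent d f)) →
      f.IsHomogeneous d → expand RatFunc.X Q = algebraMap (Polynomial ℝ) K b •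
        θ (map (algebraMap ℝ K) f) → coeffMap (homogeneousComponent d) Q = Q := by
    intro θ d b Q f hθd hf hQ
    refine (extends_homogeneousComponent d).coeffMap_eq transcendental_q ?_
    rw [hQ, map_smul, hθd, extends_homogeneousComponent, homogeneousComponent_eq_self hf]
  have hcoeff' : ∀ {d : ℕ} {Q : Polynomial (MvPolynomial (Fin n) ℝ)},
      coeffMap (homogeneousComponent d) Q = Q → ∀ i, (Q.coeff i).IsHomogeneous d := by
    intro d Q hQ i
    rw [← hQ, coeff_coeffMap]
    exact homogeneousComponent_isHomogeneous d _
  have hmem : ∀ {B : Subrepresentation (permRep ℝ n)}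
      {θ : Module.End K (MvPolynomial (Fin n) K)} {b : Polynomial ℝ}
      {Q : Polynomial (MvPolynomial (Fin n) ℝ)} {f : MvPolynomial (Fin n) ℝ}, IsGraded B →
      (∀ f, θ f ∈ (scalarExt B).toSubmodule) → expand RatFunc.X Q = algebraMap (Polynomial ℝ) K b •
        θ (map (algebraMap ℝ K) f) → ∀ t, Q.eval (C t) ∈ B.toSubmodule := by
    intro B θ b Q f hB hθB hQ t
    obtain ⟨π, hπB, hπid, -, -⟩ := exists_equivariant_projection hB
    -- The extended projection fixes the expansion of an element of `scalarExt B`, so `π` fixes each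
    -- coefficient and every specialization stays in `B`.
    have h1 : coeffMap π Q = Q := by
      refine (extends_extendOp π).coeffMap_eq transcendental_q ?_
      rw [hQ, extendOp_eq_self hπid (Submodule.smul_mem _ _ (hθB _))]
    rw [← h1, eval_coeffMap]
    exact hπB _
  let N : ℕ → Module.End ℝ (MvPolynomial (Fin n) ℝ) := fun d =>
    ((Polynomial.leval (C (t d) : MvPolynomial (Fin n) ℝ)).restrictScalars ℝ) ∘ₗ Θ d
  have hgl : ∀ {d f}, f.IsHomogeneous d → glue N f = (Θ d f).eval (C (t d)) := fun hf =>
    glue_apply N hf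
  have hNh : ∀ d f, f.IsHomogeneous d → (glue N f).IsHomogeneous d := fun d f hf => by
    rw [hgl hf, ← hcoeff hθd hf (hΘ d f hf), eval_coeffMap]
    exact homogeneousComponent_isHomogeneous d _
  have hNd := homogeneousComponent_comm_of_isHomogeneous (glue N) hNh
  have hNB : ∀ f, glue N f ∈ B.toSubmodule := fun f => mem_of_homogeneousComponent_mem _ fun d => by
    rw [hNd, hgl (homogeneousComponent_isHomogeneous d f)]
    exact hmem hB hθB (hΘ d _ (homogeneousComponent_isHomogeneous d f)) _
  have hNinv : ∀ d, ∀ f ∈ A.toSubmodule, f.IsHomogeneous d →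
      (Θ' d (glue N f)).eval (C (t d)) = (b' d * b d).eval (t d) • f := fun d f hfA hf => by
    rw [hgl hf, eval_eval_polynomial_family (hΘ d) (hΘ' d) hf
      (hcoeff' (hcoeff hθd hf (hΘ d f hf))) (hinv f hfA), Polynomial.eval_mul]
  refine subIso_of_operator (glue N) (fun s f _ => ?_) (fun d f _ => hNd d f) hA (fun f hf hf0 => ?_)
    (le_antisymm ?_ ?_)
  · refine sub_eq_zero.1 (mem_of_homogeneousComponent_mem ⊥ fun d => ?_)
    rw [Submodule.mem_bot, map_sub, sub_eq_zero, hNd, homogeneousComponent_permRep,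
      homogeneousComponent_permRep, hNd]
    have hf := homogeneousComponent_isHomogeneous d f
    have hf' : (permRep ℝ n s (homogeneousComponent d f)).IsHomogeneous d :=
      hf.rename_isHomogeneous
    rw [hgl hf, hgl hf', ← eval_coeffMap]
    congr 1
    refine ((extends_permRep s).coeffMap_eq transcendental_q ?_).symm
    rw [hΘ _ _ hf, hΘ _ _ hf', map_smul, ← hθp, extends_permRep]
  · refine mem_of_homogeneousComponent_mem ⊥ fun d => ?_
    have h1 := hNinv d _ (hA f hf d) (homogeneousComponent_isHomogeneous d f)
    rw [← hNd, hf0, map_zero, map_zero, Polynomial.eval_zero, eq_comm, smul_eq_zero] at h1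
    exact h1.resolve_left (ht d)
  · rintro _ ⟨f, -, rfl⟩
    exact hNB f
  · intro g hg
    refine mem_of_homogeneousComponent_mem _ fun d => ?_
    have hgd := homogeneousComponent_isHomogeneous d g
    have hgB := hB g hg d
    set g' := homogeneousComponent d g
    -- With the roles of `θ` and `θ'` exchanged, the specialization of `θ'` provides a preimage up
    -- to a nonzero scalar.
    have h1 := eval_eval_polynomial_family (hΘ' d) (hΘ d) hgd
      (hcoeff' (hcoeff hθd' hgd (hΘ' d g' hgd))) (hinv' g' hgB) (t d)
    have h2 : ((Θ' d g').eval (C (t d))).IsHomogeneous d := by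
      rw [← hcoeff hθd' hgd (hΘ' d g' hgd), eval_coeffMap]
      exact homogeneousComponent_isHomogeneous d _
    rw [← hgl h2, mul_comm, ← Polynomial.eval_mul] at h1
    refine ⟨((b' d * b d).eval (t d))⁻¹ • (Θ' d g').eval (C (t d)),
      Submodule.smul_mem _ _ (hmem hA hθA' (hΘ' d g' hgd) _), ?_⟩
    rw [map_smul, h1, smul_smul, inv_mul_cancel₀ (ht d), one_smul]

/-! ### Grading of the `q`-harmonics, and harmonics through power sums -/

section Harmonics

open scoped IsMulCommutative

variable {F : Type*} [Field F]

/-- The operator `T` lowers degrees by `k`. -/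
def LowersDegree (T : Module.End F (MvPolynomial (Fin n) F)) (k : ℕ) : Prop :=
  ∀ d f, f.IsHomogeneous d → T f = 0 ∨ ∃ e, e + k = d ∧ (T f).IsHomogeneous e

lemma lowersDegree_del (i : Fin n) : LowersDegree (del F i) 1 := by
  intro d f hf
  rcases d with _ | d
  · left
    have h := homogeneousComponent_eq_self hf
    rw [homogeneousComponent_zero] at h
    rw [← h]
    exact pderiv_C
  · exact Or.inr ⟨d, rfl, hf.pderiv⟩

lemma LowersDegree.mul {S T : Module.End F (MvPolynomial (Fin n) F)} {k l : ℕ}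
    (hS : LowersDegree S k) (hT : LowersDegree T l) : LowersDegree (S * T) (k + l) := by
  intro d f hf
  rw [Module.End.mul_apply]
  rcases hT d f hf with h | ⟨e, he, h⟩
  · left; rw [h, map_zero]
  · rcases hS e _ h with h' | ⟨e', he', h'⟩
    · exact Or.inl h'
    · exact Or.inr ⟨e', by omega, h'⟩

lemma LowersDegree.pow {T : Module.End F (MvPolynomial (Fin n) F)} (hT : LowersDegree T 1)
    (k : ℕ) : LowersDegree (T ^ k) k := by
  induction k with
  | zero => exact fun d f hf => Or.inr ⟨d, rfl, hf⟩
  | succ k ih => rw [pow_succ]; exact ih.mul hT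

lemma LowersDegree.add {S T : Module.End F (MvPolynomial (Fin n) F)} {k : ℕ}
    (hS : LowersDegree S k) (hT : LowersDegree T k) : LowersDegree (S + T) k := by
  intro d f hf
  rw [LinearMap.add_apply]
  rcases hT d f hf with h | ⟨e, rfl, h⟩
  · rw [h, add_zero]; exact hS d f hf
  · rcases hS _ f hf with h' | ⟨e', he', h'⟩
    · rw [h', zero_add]; exact Or.inr ⟨e, rfl, h⟩
    · obtain rfl : e' = e := by omega
      exact Or.inr ⟨e', rfl, h'.add h⟩

lemma lowersDegree_qSteenrod (q : F) (k : ℕ) : LowersDegree (qSteenrod n q k) k := by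
  refine Finset.sum_induction _ (LowersDegree · k) (fun _ _ => LowersDegree.add)
    (fun _ _ _ => Or.inl rfl) fun i _ => .add (fun d f hf => ?_) ((lowersDegree_del i).pow k)
  rw [LinearMap.smul_apply, Module.End.mul_apply]
  rcases (lowersDegree_del i).pow (k + 1) d f hf with h | ⟨e, rfl, h⟩
  · left; rw [h, map_zero, smul_zero]
  · refine Or.inr ⟨1 + e, by omega, ?_⟩
    rw [smul_eq_C_mul]
    exact ((isHomogeneous_X F i).mul h).C_mul q

/-- Nonzero images of components of different degrees have different degrees, so they cannot cancel.
-/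
lemma LowersDegree.homogeneousComponent_eq_zero {T : Module.End F (MvPolynomial (Fin n) F)}
    {k : ℕ} (hT : LowersDegree T k) {f : MvPolynomial (Fin n) F} (hf : T f = 0) (d : ℕ) :
    T (homogeneousComponent d f) = 0 := by
  rcases hT d _ (homogeneousComponent_isHomogeneous d f) with h | ⟨e, rfl, h⟩
  · exact h
  have h1 : ∀ i, homogeneousComponent e (T (homogeneousComponent i f)) =
      if i = e + k then T (homogeneousComponent (e + k) f) else 0 := by
    intro i
    split_ifs with hi
    · rw [hi, homogeneousComponent_eq_self h]
    · rcases hT i _ (homogeneousComponent_isHomogeneous i f) with h' | ⟨e', rfl, h'⟩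
      · rw [h', map_zero]
      · rw [homogeneousComponent_of_mem h', if_neg (by omega)]
  have h2 := congrArg (homogeneousComponent e) hf
  rw [← sum_homogeneousComponent f] at h2
  simp only [map_sum, h1, Finset.sum_ite_eq', Finset.mem_range, map_zero] at h2
  split_ifs at h2 with hd
  · exact h2
  · rw [MvPolynomial.homogeneousComponent_eq_zero _ _ (by omega), map_zero]

lemma isGraded_qHarmonics (n : ℕ) : IsGraded (qHarmonics n) := fun _ hf d k hk =>
  (lowersDegree_qSteenrod _ k).homogeneousComponent_eq_zero (hf k hk) d

/-- A commutator of derivations is a derivation, so it is enough that it vanishes on the variables.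
-/
lemma del_commute (i j : Fin n) : del F i * del F j = del F j * del F i :=
  LinearMap.ext fun f => by
    have h : ⁅pderiv (R := F) i, pderiv j⁆ = 0 := derivation_ext fun k => by
      rw [Derivation.commutator_apply, pderiv_X, pderiv_X, Pi.single_apply, Pi.single_apply]
      split_ifs <;> simp
    have h2 := Derivation.congr_fun h f
    rw [Derivation.commutator_apply] at h2
    exact sub_eq_zero.1 h2

/-- The commutative algebra generated by the partial derivatives. -/
def delAlgebra (F : Type*) [Field F] (n : ℕ) :
    Subalgebra F (Module.End F (MvPolynomial (Fin n) F)) :=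
  Algebra.adjoin F (Set.range (del F))

instance isMulCommutative_delAlgebra : IsMulCommutative (delAlgebra F n) :=
  Algebra.isMulCommutative_adjoin F (by rintro _ ⟨i, rfl⟩ _ ⟨j, rfl⟩; exact del_commute i j)

/-- Substitution of the partial derivatives for the variables. -/
def diffHom (F : Type*) [Field F] (n : ℕ) : MvPolynomial (Fin n) F →ₐ[F] delAlgebra F n :=
  aeval fun i => ⟨del F i, Algebra.subset_adjoin ⟨i, rfl⟩⟩

lemma diffHom_X (i : Fin n) : (diffHom F n (X i) : Module.End F (MvPolynomial (Fin n) F)) =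
    del F i := by
  rw [diffHom, aeval_X]

/-- Makes `p ↦ p(∂)` multiplicative, so that the polynomials annihilating `f` form an ideal. -/
lemma diffOp_eq_diffHom (p : MvPolynomial (Fin n) F) : diffOp p = diffHom F n p := by
  conv_rhs => rw [p.as_sum]
  rw [diffOp, map_sum, AddSubmonoidClass.coe_finsetSum]
  refine Finset.sum_congr rfl fun a _ => ?_
  rw [← mul_one (coeff a p), ← smul_eq_mul, ← smul_monomial, map_smul, smul_eq_mul, mul_one,
    Subalgebra.coe_smul]
  congr 1
  have h1 : diffHom F n (monomial a 1) =
      (List.ofFn fun i => diffHom F n (X i) ^ a i).prod := by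
    rw [List.prod_ofFn, monomial_eq, C_1, one_mul, Finsupp.prod_fintype _ _ fun i => pow_zero _,
      map_prod]
    simp only [map_pow]
  rw [h1, ← Subalgebra.coe_val, map_list_prod, List.map_ofFn]
  congr 2
  ext1 i
  rw [Function.comp_apply, Subalgebra.coe_val, SubmonoidClass.coe_pow, diffHom_X]

/-- The polynomials `p` with `p(∂) f = 0`. -/
def annihilatorIdeal (f : MvPolynomial (Fin n) F) : Ideal (MvPolynomial (Fin n) F) where
  carrier := {p | diffOp p f = 0}
  add_mem' {p p'} hp hp' := by
    simp only [Set.mem_ofPred_eq, diffOp_eq_diffHom] at hp hp' ⊢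
    rw [map_add, Subalgebra.coe_add, LinearMap.add_apply, hp, hp', add_zero]
  zero_mem' := by
    simp only [Set.mem_ofPred_eq, diffOp_eq_diffHom, map_zero]
    rfl
  smul_mem' g p hp := by
    simp only [Set.mem_ofPred_eq, diffOp_eq_diffHom] at hp ⊢
    rw [smul_eq_mul, map_mul, Subalgebra.coe_mul, Module.End.mul_apply, hp, map_zero]

lemma diffOp_psum (k : ℕ) : diffOp (psum (Fin n) F k) = ∑ i, del F i ^ k := by
  rw [diffOp_eq_diffHom, psum, map_sum, AddSubmonoidClass.coe_finsetSum]
  simp only [map_pow, SubmonoidClass.coe_pow, diffHom_X]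

lemma constantCoeff_esymm_succ (k : ℕ) :
    constantCoeff (esymm (Fin n) F (k + 1)) = 0 := by
  rw [esymm, map_sum]
  refine Finset.sum_eq_zero fun t ht => ?_
  rw [map_prod]
  obtain ⟨i, hi⟩ := Finset.card_pos.1
    ((Nat.succ_pos k).trans_eq (Finset.mem_powersetCard.1 ht).2.symm)
  exact Finset.prod_eq_zero hi (constantCoeff_X F i)

/-- In characteristic zero the power sums cut out the harmonics. -/
lemma mem_harmonics_of_powerSums [CharZero F] {f : MvPolynomial (Fin n) F}
    (h : ∀ k, 1 ≤ k → (∑ i, del F i ^ k) f = 0) : f ∈ harmonics F n := by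
  have hpsum : ∀ k, 1 ≤ k → psum (Fin n) F k ∈ annihilatorIdeal f := fun k hk => by
    change diffOp _ f = 0
    rw [diffOp_psum, h k hk]
  -- Newton's identities, divided by `k + 1`. Their sum runs over `a.1 < k + 1`, so only power sums
  -- of index at least 1 occur.
  have hesymm : ∀ k, esymm (Fin n) F (k + 1) ∈ annihilatorIdeal f := by
    intro k
    have h1 : ((k + 1 : ℕ) : MvPolynomial (Fin n) F) * esymm (Fin n) F (k + 1) ∈
        annihilatorIdeal f := by
      rw [mul_esymm_eq_sum]
      refine Ideal.mul_mem_left _ _ (Ideal.sum_mem _ fun a ha => Ideal.mul_mem_left _ _ ?_)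
      rw [Finset.mem_filter, Finset.HasAntidiagonal.mem_antidiagonal] at ha
      exact hpsum _ (by omega)
    have h2 := Ideal.mul_mem_left _ (C ((k + 1 : ℕ) : F)⁻¹) h1
    rwa [← mul_assoc, ← map_natCast (C : F →+* MvPolynomial (Fin n) F), ← C_mul,
      inv_mul_cancel₀ (Nat.cast_ne_zero.2 (Nat.succ_ne_zero k)), C_1, one_mul] at h2
  intro p hp h0
  obtain ⟨P, hP⟩ := esymmAlgHom_surjective (σ := Fin n) F (n := n) (by simp) ⟨p, hp⟩
  have hP' : aeval (fun i : Fin n => esymm (Fin n) F (i + 1)) P = p := by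
    rw [← esymmAlgHom_apply, hP]
  have key : ∀ P : MvPolynomial (Fin n) F,
      aeval (fun i : Fin n => esymm (Fin n) F (i + 1)) P - C (constantCoeff P) ∈
        annihilatorIdeal f := by
    intro P
    induction P using MvPolynomial.induction_on with
    | C a => rw [aeval_C, constantCoeff_C, algebraMap_eq, sub_self]; exact zero_mem _
    | add P P' hP hP' =>
      have := add_mem hP hP'
      rwa [sub_add_sub_comm, ← map_add, ← map_add, ← map_add] at this
    | mul_X P i _ =>
      rw [map_mul, map_mul, constantCoeff_X, mul_zero, C_0, sub_zero, aeval_X]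
      exact Ideal.mul_mem_left _ _ (hesymm i)
  -- The `esymm (i + 1)` have no constant term, so `P` inherits the zero constant term of `p`.
  have hc : ∀ P : MvPolynomial (Fin n) F,
      constantCoeff (aeval (fun i : Fin n => esymm (Fin n) F (i + 1)) P) = constantCoeff P := by
    intro P
    induction P using MvPolynomial.induction_on with
    | C a => rw [aeval_C, algebraMap_eq]
    | add P P' hP hP' => simp only [map_add, hP, hP']
    | mul_X P i _ =>
      rw [map_mul, map_mul, map_mul, aeval_X, constantCoeff_esymm_succ, constantCoeff_X,
        mul_zero, mul_zero]
  have h3 := key P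
  rw [← hc P, hP', h0, C_0, sub_zero] at h3
  exact h3

end Harmonics

/-! ### Harmonicity of first terms and the resulting isomorphisms -/

/-- The summand `q xᵢ ∂ᵢ^(k+1)` contributes nothing to the constant coefficient in `q`, which leaves
the power sum of derivatives. -/
lemma powerSums_reduction (g : MvPolynomial (Fin n) ℝ)
    (hg : g ∈ (reduction RatFunc.X (qHarmonics n)).toSubmodule) (k : ℕ) (hk : 1 ≤ k) :
    (∑ i, del ℝ i ^ k) g = 0 := by
  obtain ⟨Q, hQ, rfl⟩ := hg
  have hD : Extends (∑ i : Fin n, del ℝ i ^ k) (∑ i : Fin n, del K i ^ k) :=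
    .sum _ fun i => (extends_del i).pow k
  have hE : Extends (∑ i : Fin n, mulX ℝ i * del ℝ i ^ (k + 1))
      (∑ i : Fin n, mulX K i * del K i ^ (k + 1)) :=
    .sum _ fun i => (extends_mulX i).comp ((extends_del i).pow _)
  have h := hQ k hk
  rw [qSteenrod, Finset.sum_add_distrib, ← Finset.smul_sum, LinearMap.add_apply,
    LinearMap.smul_apply, hD.expand, hE.expand, smul_eq_C_mul, ← expand_X, ← map_mul, ← map_add,
    ← map_zero (expand RatFunc.X)] at h
  have h2 := congrArg (fun P => Polynomial.coeff P 0) (expand_injective transcendental_q h)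
  simpa only [Polynomial.coeff_add, Polynomial.coeff_X_mul_zero, zero_add, coeff_coeffMap,
    Polynomial.coeff_zero] using h2

lemma reduction_le_harmonics (n : ℕ) :
    (reduction RatFunc.X (qHarmonics n)).toSubmodule ≤ harmonics ℝ n := fun g hg =>
  mem_harmonics_of_powerSums (powerSums_reduction g hg)

lemma scalarExt_reduction_le_harmonics (n : ℕ) :
    (scalarExt (reduction RatFunc.X (qHarmonics n))).toSubmodule ≤ harmonics K n :=
  scalarExt_le fun g hg => mem_harmonics_of_powerSums fun k hk => by
    have hD : Extends (∑ i : Fin n, del ℝ i ^ k) (∑ i : Fin n, del K i ^ k) :=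
      .sum _ fun i => (extends_del i).pow k
    rw [hD, powerSums_reduction g hg k hk, map_zero]

lemma subIso_refl {F : Type*} [Field F] {n : ℕ} (U : Subrepresentation (permRep F n)) :
    SubIso U U :=
  ⟨LinearEquiv.refl F _, fun _ _ => rfl, fun d => by simp⟩

lemma subIso_qHarmonics_q (n : ℕ) :
    SubIso (qHarmonics n) (scalarExt (firstTermSpan n)) := by
  rw [firstTermSpan_eq_reduction]
  exact subIso_scalarExt_reduction transcendental_q (isGraded_qHarmonics n)
    fun f _ hf => exists_expand_q hf

lemma subIso_qHarmonics_q_inv (n : ℕ) :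
    SubIso (qHarmonics n) (scalarExt (lastTermSpan n)) := by
  rw [lastTermSpan_eq_reduction]
  exact subIso_scalarExt_reduction transcendental_q_inv (isGraded_qHarmonics n)
    fun f _ hf => exists_expand_q_inv hf

end QHarm

end

theorem mainTheorem6 (n : ℕ) :
    (QHarm.IsGraded (QHarm.firstTermSpan n) ∧ QHarm.IsGraded (QHarm.lastTermSpan n) ∧
      QHarm.IsGraded (QHarm.qHarmonics n)) ∧
    (QHarm.SubIso (QHarm.firstTermSpan n) (QHarm.lastTermSpan n) ∧
      QHarm.ExtIso (QHarm.firstTermSpan n) (QHarm.qHarmonics n) ∧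
      QHarm.ExtIso (QHarm.lastTermSpan n) (QHarm.qHarmonics n)) ∧
    (QHarm.EmbedsInHarmonics (QHarm.firstTermSpan n) ∧
      QHarm.EmbedsInHarmonics (QHarm.lastTermSpan n) ∧
      QHarm.EmbedsInHarmonics (QHarm.qHarmonics n)) := by
  have hU := QHarm.isGraded_qHarmonics n
  have hF : QHarm.IsGraded (QHarm.firstTermSpan n) := by
    rw [QHarm.firstTermSpan_eq_reduction]; exact QHarm.isGraded_reduction _ hU
  have hL : QHarm.IsGraded (QHarm.lastTermSpan n) := by
    rw [QHarm.lastTermSpan_eq_reduction]; exact QHarm.isGraded_reduction _ hU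
  have hUF := QHarm.subIso_qHarmonics_q n
  have hUL := QHarm.subIso_qHarmonics_q_inv n
  have hFL : QHarm.SubIso (QHarm.firstTermSpan n) (QHarm.lastTermSpan n) :=
    QHarm.subIso_of_subIso_scalarExt hF hL
      (QHarm.gradedIso_trans (QHarm.gradedIso_symm hUF) hUL)
  have hFH : (QHarm.firstTermSpan n).toSubmodule ≤ QHarm.harmonics ℝ n := by
    rw [QHarm.firstTermSpan_eq_reduction]; exact QHarm.reduction_le_harmonics n
  have hFH' : (QHarm.scalarExt (QHarm.firstTermSpan n)).toSubmodule ≤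
      QHarm.harmonics QHarm.K n := by
    rw [QHarm.firstTermSpan_eq_reduction]; exact QHarm.scalarExt_reduction_le_harmonics n
  exact ⟨⟨hF, hL, hU⟩,
    ⟨hFL, QHarm.gradedIso_trans (QHarm.extIso_scalarExt hF) (QHarm.gradedIso_symm hUF),
      QHarm.gradedIso_trans (QHarm.extIso_scalarExt hL) (QHarm.gradedIso_symm hUL)⟩,
    -- All three targets are the first terms or their span over `ℝ(q)`; the last terms are carried
    -- there by `hFL`.
    ⟨_, hFH, hF, QHarm.subIso_refl _⟩, ⟨_, hFH, hF, QHarm.gradedIso_symm hFL⟩,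
    ⟨_, hFH', QHarm.isGraded_scalarExt hF, hUF⟩⟩
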